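/- Let $\mathcal H$ be a complex Hilbert space and let $A$ be a bounded positive injective operator on $\mathcal H$, with the associated inner product $[f,g]=\langle Af,g\rangle$. Let $\mathcal B_s^A(\mathcal H)=\{B\in\mathcal B(\mathcal H): B^*A=AB\}$ and $\mathcal B_{as}^A(\mathcal H)=\{B\in\mathcal B(\mathcal H): B^*A=-AB\}$ be the real Banach spaces (with the operator norm) of $A$-symmetric and $A$-anti-symmetric operators. Let $Gr_A=\{Q\in\mathcal B(\mathcal H): Q^2=Q,\ Q^*A=AQ\}\subset\mathcal B_s^A(\mathcal H)$ be the compatible Grassmannian, with the norm topology, and let $\mathcal G_A=\{G\in Gl(\mathcal H): G^*AG=A\}$ be the group of $A$-unitary operators, a real Banach-Lie group with the norm topology, modelled on $\mathcal B_{as}^A(\mathcal H)$. A subset $S$ of a real Banach space $E$ is called a complemented $C^\infty$ submanifold of $E$ if around each point of $S$ there is a $C^\infty$ diffeomorphism between open subsets of $E$ that carries $S$ to a closed complemented linear subspace of $E$ (which may depend on the point). Then for each $Q_0\in Gr_A$: 1. the orbit $\mathcal G_A\cdot Q_0=\{GQ_0G^{-1}: G\in\mathcal G_A\}$ is a complemented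 $C^\infty$ submanifold of $\mathcal B_s^A(\mathcal H)$; 2. the map $\pi_{Q_0}:\mathcal G_A\to\mathcal G_A\cdot Q_0$, $\pi_{Q_0}(G)=GQ_0G^{-1}$, is a $C^\infty$ submersion (that is, in suitable local charts it is a projection $(u,v)\mapsto u$ of a product of Banach spaces); 3. the orbit $\mathcal G_A\cdot Q_0$ is a union of connected components of $Gr_A$. Moreover, $Gr_A$ is a complemented $C^\infty$ submanifold of $\mathcal B_s^A(\mathcal H)$. -/

import Mathlib

open Topology
open scoped InnerProductSpace Manifold ContDiff

noncomputable section

namespace CompatGr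

section Submanifold

variable {E : Type*} [NormedAddCommGroup E] [NormedSpace ℝ E]

/-- A subset `S` of a real Banach space `E` is a complemented (that is, split) `C^∞` submanifold:
around each of its points there is a `C^∞` diffeomorphism `φ` between open subsets of `E` which
carries `S` to a closed complemented real linear subspace `F` of `E`. -/
def IsComplementedSubmanifold (S : Set E) : Prop :=
  ∀ p ∈ S, ∃ (φ : OpenPartialHomeomorph E E) (F : Submodule ℝ E),
    p ∈ φ.source ∧
    ContDiffOn ℝ ∞ φ φ.source ∧ ContDiffOn ℝ ∞ φ.symm φ.target ∧
    F.ClosedComplemented ∧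
    ∀ x ∈ φ.source, x ∈ S ↔ φ x ∈ F

end Submanifold

section CodRestrict

universe u

variable {E F G : Type u} [NormedAddCommGroup E] [NormedSpace ℝ E]
  [NormedAddCommGroup F] [NormedSpace ℝ F] [NormedAddCommGroup G] [NormedSpace ℝ G]

theorem hasFDerivAt_of_isometry_comp [CompleteSpace F] (ι : F →ₗᵢ[ℝ] G) {f : E → F} {x : E}
    {L : E →L[ℝ] G} (h : HasFDerivAt (fun y => ι (f y)) L x) :
    ∃ L' : E →L[ℝ] F, HasFDerivAt f L' x := by
  have hcl : IsClosed (Set.range ι) := ι.isometry.isClosedEmbedding.isClosed_range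
  have hmem : ∀ v, L v ∈ Set.range ι := by
    intro v
    have := h.hasLineDerivAt v
    have h2 := (hasDerivAt_iff_tendsto_slope_zero).1 this
    refine hcl.mem_of_tendsto h2 (Filter.Eventually.of_forall fun t => ?_)
    refine ⟨t⁻¹ • (f (x + (0 + t) • v) - f (x + (0 : ℝ) • v)), ?_⟩
    simp
  choose g hg using hmem
  let L' : E →L[ℝ] F := LinearMap.mkContinuous
    { toFun := g
      map_add' := fun a b => ι.injective (by simp [hg])
      map_smul' := fun c a => ι.injective (by simp [hg]) } ‖L‖ (fun v => by
        change ‖g v‖ ≤ _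
        rw [← ι.norm_map, hg]; exact L.le_opNorm v)
  refine ⟨L', ?_⟩
  have hL' : ∀ v, ι (L' v) = L v := hg
  rw [hasFDerivAt_iff_isLittleO] at h ⊢
  refine (Asymptotics.IsLittleO.of_norm_left ?_)
  refine h.norm_left.congr_left fun y => ?_
  rw [← hL', ← map_sub, ← map_sub, ι.norm_map]

/-- A function into a closed subspace is `C^∞` when it is `C^∞` into the ambient space. -/
theorem contDiffOn_of_isometry_comp_nat (n : ℕ) : ∀ {F G : Type u} [NormedAddCommGroup F]
    [NormedSpace ℝ F] [NormedAddCommGroup G] [NormedSpace ℝ G] [CompleteSpace F]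
    (ι : F →ₗᵢ[ℝ] G) {f : E → F} {s : Set E} (_ : IsOpen s)
    (_ : ContDiffOn ℝ n (fun y => ι (f y)) s), ContDiffOn ℝ n f s := by
  induction n with
  | zero =>
    intro F G _ _ _ _ _ ι f s hs h
    simp only [Nat.cast_zero, contDiffOn_zero] at h ⊢
    exact ι.isometry.isEmbedding.continuousOn_iff.2 h
  | succ n ih =>
    intro F G _ _ _ _ _ ι f s hs h
    push_cast at h ⊢
    rw [contDiffOn_succ_iff_fderiv_of_isOpen hs] at h ⊢
    have hd : DifferentiableOn ℝ f s := fun x hx => by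
      obtain ⟨L', hL'⟩ := hasFDerivAt_of_isometry_comp ι
        ((h.1 x hx).differentiableAt (hs.mem_nhds hx)).hasFDerivAt
      exact hL'.differentiableAt.differentiableWithinAt
    refine ⟨hd, fun hω => absurd hω (by simp), ?_⟩
    let κ : (E →L[ℝ] F) →ₗᵢ[ℝ] (E →L[ℝ] G) :=
      { toFun := fun L => ι.toContinuousLinearMap.comp L
        map_add' := fun a b => by ext; simp
        map_smul' := fun c a => by ext; simp
        norm_map' := fun L => ι.norm_toContinuousLinearMap_comp }
    refine ih κ hs (h.2.2.congr fun x hx => ?_)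
    have hdx := ((hd x hx).differentiableAt (hs.mem_nhds hx)).hasFDerivAt
    exact ((ι.toContinuousLinearMap.hasFDerivAt.comp x hdx).fderiv).symm

theorem contDiffAt_of_isometry_comp [CompleteSpace F] (ι : F →ₗᵢ[ℝ] G) {f : E → F} {x : E}
    (h : ContDiffAt ℝ ∞ (fun y => ι (f y)) x) : ContDiffAt ℝ ∞ f x := by
  refine contDiffAt_infty.2 fun n => ?_
  obtain ⟨u, hu, hf⟩ := (contDiffAt_infty.1 h n).contDiffOn le_rfl (by simp)
  obtain ⟨v, hvu, hv, hxv⟩ := mem_nhds_iff.1 (by simpa using hu)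
  exact (contDiffOn_of_isometry_comp_nat n ι hv (hf.mono hvu)).contDiffAt (hv.mem_nhds hxv)

theorem contDiffOn_of_isometry_comp [CompleteSpace F] (ι : F →ₗᵢ[ℝ] G) {f : E → F} {s : Set E}
    (hs : IsOpen s) (h : ContDiffOn ℝ ∞ (fun y => ι (f y)) s) : ContDiffOn ℝ ∞ f s :=
  contDiffOn_infty.2 fun n =>
    contDiffOn_of_isometry_comp_nat n ι hs (contDiffOn_infty.1 h n)

end CodRestrict

variable {H : Type*} [NormedAddCommGroup H] [InnerProductSpace ℂ H] [CompleteSpace H]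

/-- The sesquilinear form `[f, g] = ⟨A f, g⟩` (an inner product if `A` is positive and injective). -/
def form (A : H →L[ℂ] H) (f g : H) : ℂ := ⟪A f, g⟫_ℂ

/-- The real vector space of bounded `A`-symmetric operators, with the operator norm. -/
def symmOp (A : H →L[ℂ] H) : Submodule ℝ (H →L[ℂ] H) where
  carrier := {B | ∀ f g, form A (B f) g = form A f (B g)}
  add_mem' {B C} hB hC f g := by
    have h1 := hB f g
    have h2 := hC f g
    simp only [form] at *
    simp [h1, h2]
  zero_mem' f g := by simp [form]
  smul_mem' c B hB f g := by
    have h1 := hB f g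
    simp only [form] at *
    have : ∀ x, (c • B) x = (c : ℂ) • B x := fun x => rfl
    simp [this, h1]

/-- The real vector space of bounded `A`-antisymmetric operators, with the operator norm. -/
def antiOp (A : H →L[ℂ] H) : Submodule ℝ (H →L[ℂ] H) where
  carrier := {B | ∀ f g, form A (B f) g = -form A f (B g)}
  add_mem' {B C} hB hC f g := by
    have h1 := hB f g
    have h2 := hC f g
    simp only [form] at *
    simp only [add_apply, map_add, inner_add_left, inner_add_right, h1, h2]
    ring
  zero_mem' f g := by simp [form]
  smul_mem' c B hB f g := by
    have h1 := hB f g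
    simp only [form] at *
    have : ∀ x, (c • B) x = (c : ℂ) • B x := fun x => rfl
    simp [this, h1]

/-- The group of `A`-unitary operators: the bounded invertible operators which preserve the form
`[ , ]`. Its topology is the one induced by the operator norm. -/
def unitaryGp (A : H →L[ℂ] H) : Subgroup (H →L[ℂ] H)ˣ where
  carrier := {G | ∀ f g, form A ((G : H →L[ℂ] H) f) ((G : H →L[ℂ] H) g) = form A f g}
  mul_mem' {G K} hG hK f g := by
    simpa [hK f g] using hG ((K : H →L[ℂ] H) f) ((K : H →L[ℂ] H) g)
  one_mem' f g := rfl
  inv_mem' {G} hG f g := by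
    have h : ∀ x, (G : H →L[ℂ] H) (((G⁻¹ : (H →L[ℂ] H)ˣ) : H →L[ℂ] H) x) = x := fun x =>
      congrArg (fun T : H →L[ℂ] H => T x) G.mul_inv
    rw [← hG, h, h]

variable {A : H →L[ℂ] H}

theorem mem_symmOp {B : H →L[ℂ] H} : B ∈ symmOp A ↔ star B * A = A * B := by
  constructor
  · intro h
    ext f
    refine ext_inner_right ℂ fun g => ?_
    have := h f g
    simp only [form] at this
    simp [ContinuousLinearMap.star_eq_adjoint, ContinuousLinearMap.adjoint_inner_left, this]
  · intro h f g
    have := congrArg (fun T : H →L[ℂ] H => T f) h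
    simp only [mul_apply_eq_comp] at this
    rw [form, form, ← this, ContinuousLinearMap.star_eq_adjoint,
      ContinuousLinearMap.adjoint_inner_left]

theorem mem_antiOp {B : H →L[ℂ] H} : B ∈ antiOp A ↔ star B * A = -(A * B) := by
  constructor
  · intro h
    ext f
    refine ext_inner_right ℂ fun g => ?_
    have := h f g
    simp only [form] at this
    simp [ContinuousLinearMap.star_eq_adjoint, ContinuousLinearMap.adjoint_inner_left, this]
  · intro h f g
    have := congrArg (fun T : H →L[ℂ] H => T f) (neg_eq_iff_eq_neg.2 h)
    simp only [neg_apply, mul_apply_eq_comp] at this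
    rw [form, form, ← this, ContinuousLinearMap.star_eq_adjoint, inner_neg_left,
      ContinuousLinearMap.adjoint_inner_left]

theorem mem_unitaryGp {G : (H →L[ℂ] H)ˣ} :
    G ∈ unitaryGp A ↔ star (G : H →L[ℂ] H) * A * G = A := by
  constructor
  · intro h
    ext f
    refine ext_inner_right ℂ fun g => ?_
    have := h f g
    simp only [form] at this
    simp [ContinuousLinearMap.star_eq_adjoint, ContinuousLinearMap.adjoint_inner_left, this]
  · intro h f g
    have := congrArg (fun T : H →L[ℂ] H => T f) h
    simp only [mul_apply_eq_comp] at this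
    rw [form, form, ← this, ContinuousLinearMap.star_eq_adjoint,
      ContinuousLinearMap.adjoint_inner_left]

theorem isClosed_antiOp : IsClosed (antiOp A : Set (H →L[ℂ] H)) := by
  have : (antiOp A : Set (H →L[ℂ] H)) = {B | star B * A = -(A * B)} := by
    ext B; exact mem_antiOp
  rw [this]
  exact isClosed_eq (by fun_prop) (by fun_prop)

theorem isClosed_symmOp : IsClosed (symmOp A : Set (H →L[ℂ] H)) := by
  have : (symmOp A : Set (H →L[ℂ] H)) = {B | star B * A = A * B} := by
    ext B; exact mem_symmOp
  rw [this]
  exact isClosed_eq (by fun_prop) (by fun_prop)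

instance : CompleteSpace (antiOp A) := isClosed_antiOp.completeSpace_coe

instance : CompleteSpace (symmOp A) := isClosed_symmOp.completeSpace_coe

/-! ### The Banach-Lie group structure of the group of `A`-unitary operators

It is modelled on the real Banach space of `A`-antisymmetric operators; the chart at `G₀` is the
left translate by `G₀` of the Cayley transform `K ↦ (K - 1) (K + 1)⁻¹`. -/

section Cayley

variable {R : Type*} [Ring R]

/-- The Cayley transform `K ↦ (K - 1) (K + 1)⁻¹` (with value `0` if `K + 1` is not invertible). -/
def cayley (K : R) : R := (K - 1) * Ring.inverse (K + 1)

/-- The inverse Cayley transform `X ↦ (1 + X) (1 - X)⁻¹`. -/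
def cayleyInv (X : R) : R := (1 + X) * Ring.inverse (1 - X)

theorem cayley_mul {K : R} (h : IsUnit (K + 1)) : cayley K * (K + 1) = K - 1 := by
  rw [cayley, mul_assoc, Ring.inverse_mul_cancel _ h, mul_one]

theorem cayleyInv_mul {X : R} (h : IsUnit (1 - X)) : cayleyInv X * (1 - X) = 1 + X := by
  rw [cayleyInv, mul_assoc, Ring.inverse_mul_cancel _ h, mul_one]

theorem cayley_anti [StarRing R] {a K : R} (hK : star K * a * K = a) :
    star (cayley K) * a = -(a * cayley K) := by
  by_cases h : IsUnit (K + 1)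
  · have hs : IsUnit (star (K + 1)) := h.star
    apply hs.mul_left_cancel
    apply h.mul_right_cancel
    have h1 : star (K + 1) * star (cayley K) = star (K - 1) := by
      rw [← star_mul, cayley_mul h]
    have e1 : star (K + 1) * (star (cayley K) * a) * (K + 1) = star (K - 1) * a * (K + 1) := by
      rw [← h1]; simp only [mul_assoc]
    have e2 : star (K + 1) * -(a * cayley K) * (K + 1) = -(star (K + 1) * a * (K - 1)) := by
      rw [← cayley_mul h]; simp only [mul_assoc, mul_neg, neg_mul]
    rw [e1, e2]
    simp only [star_add, star_sub, star_one, mul_add, add_mul, mul_sub, sub_mul, hK, one_mul,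
      mul_one]
    abel
  · simp [cayley, Ring.inverse_non_unit _ h]

theorem cayleyInv_unitary [StarRing R] {a X : R} (hX : star X * a = -(a * X))
    (h : IsUnit (1 - X)) : star (cayleyInv X) * a * cayleyInv X = a := by
  have hs : IsUnit (star (1 - X)) := h.star
  apply hs.mul_left_cancel
  apply h.mul_right_cancel
  have h1 : star (1 - X) * star (cayleyInv X) = star (1 + X) := by
    rw [← star_mul, cayleyInv_mul h]
  have e1 : star (1 - X) * (star (cayleyInv X) * a * cayleyInv X) * (1 - X)
      = star (1 + X) * a * (1 + X) := by
    rw [← h1, ← cayleyInv_mul h]; simp only [mul_assoc]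
  rw [e1]
  simp only [star_add, star_sub, star_one, mul_add, add_mul, mul_sub, sub_mul, hX, one_mul,
      mul_one]
  abel

theorem isUnit_cayleyInv {X : R} (h : IsUnit (1 - X)) (h' : IsUnit (1 + X)) :
    IsUnit (cayleyInv X) := h'.mul h.ringInverse

theorem cayleyInv_add_one {X : R} (h : IsUnit (1 - X)) :
    cayleyInv X + 1 = 2 * Ring.inverse (1 - X) := by
  apply h.mul_right_cancel
  rw [add_mul, cayleyInv_mul h, mul_assoc, Ring.inverse_mul_cancel _ h, mul_one, one_mul,
    ← one_add_one_eq_two]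
  abel

theorem one_sub_cayley {K : R} (h : IsUnit (K + 1)) :
    1 - cayley K = 2 * Ring.inverse (K + 1) := by
  apply h.mul_right_cancel
  rw [sub_mul, cayley_mul h, mul_assoc, Ring.inverse_mul_cancel _ h, mul_one, one_mul,
    ← one_add_one_eq_two]
  abel

theorem one_add_cayley {K : R} (h : IsUnit (K + 1)) :
    1 + cayley K = 2 * K * Ring.inverse (K + 1) := by
  apply h.mul_right_cancel
  rw [add_mul, cayley_mul h, mul_assoc, Ring.inverse_mul_cancel _ h, mul_one, one_mul, two_mul]
  abel

theorem isUnit_cayleyInv_add_one (h2 : IsUnit (2 : R)) {X : R} (h : IsUnit (1 - X)) : IsUnit (cayleyInv X + 1) := by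
  rw [cayleyInv_add_one h]; exact h2.mul h.ringInverse

theorem isUnit_one_sub_cayley (h2 : IsUnit (2 : R)) {K : R} (h : IsUnit (K + 1)) : IsUnit (1 - cayley K) := by
  rw [one_sub_cayley h]; exact h2.mul h.ringInverse

theorem isUnit_one_add_cayley (h2 : IsUnit (2 : R)) {K : R} (hK : IsUnit K)
    (h : IsUnit (K + 1)) :
    IsUnit (1 + cayley K) := by
  rw [one_add_cayley h]; exact (h2.mul hK).mul h.ringInverse

theorem cayley_cayleyInv (h2 : IsUnit (2 : R)) {X : R} (h : IsUnit (1 - X)) : cayley (cayleyInv X) = X := by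
  have h' := isUnit_cayleyInv_add_one h2 h
  apply h'.mul_right_cancel
  rw [cayley_mul h']
  apply h.mul_right_cancel
  have e : X * (cayleyInv X + 1) * (1 - X) = X * (1 + X) + X * (1 - X) := by
    rw [mul_assoc, add_mul, cayleyInv_mul h, one_mul, mul_add]
  rw [e, sub_mul, cayleyInv_mul h]
  simp only [mul_add, mul_sub, mul_one, one_mul]
  abel

theorem cayleyInv_cayley (h2 : IsUnit (2 : R)) {K : R} (h : IsUnit (K + 1)) : cayleyInv (cayley K) = K := by
  have h' := isUnit_one_sub_cayley h2 h
  apply h'.mul_right_cancel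
  rw [cayleyInv_mul h', one_sub_cayley h, one_add_cayley h, ← mul_assoc, mul_two, two_mul]

end Cayley

theorem isUnit_two_op {H : Type*} [NormedAddCommGroup H] [InnerProductSpace ℂ H] :
    IsUnit (2 : H →L[ℂ] H) := by
  have : (2 : H →L[ℂ] H) = algebraMap ℂ (H →L[ℂ] H) 2 := (map_ofNat _ 2).symm
  rw [this]
  exact (IsUnit.mk0 (2 : ℂ) two_ne_zero).map _

theorem continuousAt_inverse_op {x : H →L[ℂ] H} (h : IsUnit x) :
    ContinuousAt Ring.inverse x := by
  obtain ⟨u, rfl⟩ := h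
  exact NormedRing.inverse_continuousAt u

open Classical in
/-- The inverse of the chart at `1` of the group of `A`-unitary operators. -/
def cayleyInvGp (A : H →L[ℂ] H) (X : antiOp A) : unitaryGp A :=
  if h : IsUnit (1 - (X : H →L[ℂ] H)) ∧ IsUnit (1 + (X : H →L[ℂ] H)) then
    ⟨(isUnit_cayleyInv h.1 h.2).unit,
      mem_unitaryGp.2 (cayleyInv_unitary (mem_antiOp.1 X.2) h.1)⟩
  else 1

theorem coe_cayleyInvGp {X : antiOp A} (h : IsUnit (1 - (X : H →L[ℂ] H)))
    (h' : IsUnit (1 + (X : H →L[ℂ] H))) :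
    (((cayleyInvGp A X : unitaryGp A) : (H →L[ℂ] H)ˣ) : H →L[ℂ] H) = cayleyInv (X : H →L[ℂ] H) := by
  rw [cayleyInvGp, dif_pos ⟨h, h'⟩]; rfl

/-- The embedding of the group of `A`-unitary operators into the bounded operators. -/
abbrev toOp (G : unitaryGp A) : H →L[ℂ] H := ((G : (H →L[ℂ] H)ˣ) : H →L[ℂ] H)

theorem isEmbedding_toOp : IsEmbedding (toOp : unitaryGp A → H →L[ℂ] H) :=
  Units.isOpenEmbedding_val.isEmbedding.comp IsEmbedding.subtypeVal

/-- The chart at `G₀`: the Cayley transform of `G₀⁻¹ G`, on the open set where `G₀⁻¹ G + 1` is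
invertible. -/
def cayleyChart (G₀ : unitaryGp A) : OpenPartialHomeomorph (unitaryGp A) (antiOp A) where
  toFun G := ⟨cayley (toOp (G₀⁻¹ * G)), mem_antiOp.2 (cayley_anti (mem_unitaryGp.1 (G₀⁻¹ * G).2))⟩
  invFun X := G₀ * cayleyInvGp A X
  source := {G | IsUnit (toOp (G₀⁻¹ * G) + 1)}
  target := {X | IsUnit (1 - (X : H →L[ℂ] H)) ∧ IsUnit (1 + (X : H →L[ℂ] H))}
  map_source' G hG := ⟨isUnit_one_sub_cayley isUnit_two_op hG,
    isUnit_one_add_cayley isUnit_two_op (Units.isUnit _) hG⟩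
  map_target' X hX := by
    rw [Set.mem_ofPred_eq, inv_mul_cancel_left, toOp, coe_cayleyInvGp hX.1 hX.2]
    exact isUnit_cayleyInv_add_one isUnit_two_op hX.1
  left_inv' G hG := by
    refine isEmbedding_toOp.injective ?_
    have h1 := isUnit_one_sub_cayley isUnit_two_op hG
    have h2 := isUnit_one_add_cayley isUnit_two_op (Units.isUnit _) hG
    change toOp G₀ * toOp (cayleyInvGp A _) = toOp G
    rw [toOp, toOp, coe_cayleyInvGp h1 h2, cayleyInv_cayley isUnit_two_op hG]
    change toOp (G₀ * (G₀⁻¹ * G)) = toOp G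
    rw [mul_inv_cancel_left]
  right_inv' X hX := by
    refine Subtype.ext ?_
    change cayley (toOp (G₀⁻¹ * (G₀ * cayleyInvGp A X))) = _
    rw [inv_mul_cancel_left, toOp, coe_cayleyInvGp hX.1 hX.2, cayley_cayleyInv isUnit_two_op hX.1]
  open_source := by
    refine Units.isOpen.preimage ?_
    exact (isEmbedding_toOp.continuous.comp (continuous_const_mul _)).add continuous_const
  open_target := by
    refine (Units.isOpen.preimage ?_).inter (Units.isOpen.preimage ?_) <;> fun_prop
  continuousOn_toFun := by
    refine (IsEmbedding.subtypeVal.continuousOn_iff).2 fun G hG => ContinuousAt.continuousWithinAt ?_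
    have hc : ContinuousAt (fun G : unitaryGp A => toOp (G₀⁻¹ * G)) G :=
      (isEmbedding_toOp.continuous.comp (continuous_const_mul _)).continuousAt
    exact (hc.sub continuousAt_const).mul
      (ContinuousAt.comp (f := fun G => toOp (G₀⁻¹ * G) + 1) (continuousAt_inverse_op hG)
        (hc.add continuousAt_const))
  continuousOn_invFun := by
    refine (continuous_const_mul G₀).comp_continuousOn ?_
    refine (isEmbedding_toOp.continuousOn_iff).2 ?_
    refine ContinuousOn.congr (f := fun X : antiOp A => cayleyInv (X : H →L[ℂ] H)) ?_
      fun X hX => coe_cayleyInvGp hX.1 hX.2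
    intro X hX
    refine ContinuousAt.continuousWithinAt ?_
    exact ContinuousAt.mul (by fun_prop)
      (ContinuousAt.comp (f := fun X : antiOp A => 1 - (X : H →L[ℂ] H))
        (continuousAt_inverse_op hX.1) (by fun_prop))

theorem mem_cayleyChart_source (G : unitaryGp A) : G ∈ (cayleyChart G).source := by
  change IsUnit (toOp (G⁻¹ * G) + 1)
  rw [inv_mul_cancel]
  change IsUnit ((1 : H →L[ℂ] H) + 1)
  rw [one_add_one_eq_two]
  exact isUnit_two_op

instance : ChartedSpace (antiOp A) (unitaryGp A) where
  atlas := Set.range cayleyChart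
  chartAt := cayleyChart
  mem_chart_source := mem_cayleyChart_source
  chart_mem_atlas G := ⟨G, rfl⟩

theorem contDiffAt_inverse_op {x : H →L[ℂ] H} (h : IsUnit x) :
    ContDiffAt ℝ ∞ (Ring.inverse : (H →L[ℂ] H) → H →L[ℂ] H) x := by
  obtain ⟨u, rfl⟩ := h
  exact contDiffAt_ringInverse ℝ u

theorem contDiffAt_cayley {x : H →L[ℂ] H} (h : IsUnit (x + 1)) :
    ContDiffAt ℝ ∞ (cayley : (H →L[ℂ] H) → H →L[ℂ] H) x :=
  ContDiffAt.mul (by fun_prop) (ContDiffAt.comp (f := fun y : H →L[ℂ] H => y + 1) x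
    (contDiffAt_inverse_op h) (by fun_prop))

theorem contDiffAt_cayleyInv {x : H →L[ℂ] H} (h : IsUnit (1 - x)) :
    ContDiffAt ℝ ∞ (cayleyInv : (H →L[ℂ] H) → H →L[ℂ] H) x :=
  ContDiffAt.mul (by fun_prop) (ContDiffAt.comp (f := fun y : H →L[ℂ] H => 1 - y) x
    (contDiffAt_inverse_op h) (by fun_prop))

theorem contDiffAt_chart_formula (T : H →L[ℂ] H) {X : antiOp A}
    (h : IsUnit (1 - (X : H →L[ℂ] H))) (h' : IsUnit (T * cayleyInv (X : H →L[ℂ] H) + 1)) :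
    ContDiffAt ℝ ∞ (fun X : antiOp A => cayley (T * cayleyInv (X : H →L[ℂ] H))) X := by
  have h1 : ContDiffAt ℝ ∞ (fun X : antiOp A => T * cayleyInv (X : H →L[ℂ] H)) X :=
    contDiffAt_const.mul (ContDiffAt.comp X (contDiffAt_cayleyInv h)
      (antiOp A).subtypeL.contDiff.contDiffAt)
  exact ContDiffAt.comp X (contDiffAt_cayley h') h1

instance : IsManifold 𝓘(ℝ, antiOp A) ∞ (unitaryGp A) := by
  refine isManifold_of_contDiffOn _ _ _ ?_
  rintro _ _ ⟨G₁, rfl⟩ ⟨G₂, rfl⟩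
  simp only [modelWithCornersSelf_coe, modelWithCornersSelf_coe_symm, Function.id_comp,
    Function.comp_id, Set.preimage_id, Set.range_id, Set.inter_univ]
  intro X hX
  obtain ⟨hX1, hX2⟩ := hX
  have hX3 : IsUnit (toOp (G₂⁻¹ * (G₁ * cayleyInvGp A X)) + 1) := hX2
  have e : ∀ Y ∈ (cayleyChart G₁).target, toOp (G₂⁻¹ * (G₁ * cayleyInvGp A Y))
      = toOp (G₂⁻¹ * G₁) * cayleyInv (Y : H →L[ℂ] H) := fun Y hY => by
    rw [← coe_cayleyInvGp hY.1 hY.2, ← mul_assoc]; rfl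
  refine ContDiffAt.contDiffWithinAt ?_
  refine contDiffAt_of_isometry_comp (antiOp A).subtypeₗᵢ ?_
  rw [e X hX1] at hX3
  refine (contDiffAt_chart_formula (toOp (G₂⁻¹ * G₁)) hX1.1 hX3).congr_of_eventuallyEq ?_
  filter_upwards [(cayleyChart G₁).open_target.mem_nhds hX1] with Y hY
  exact congrArg cayley (e Y hY)

theorem contMDiff_toOp :
    ContMDiff 𝓘(ℝ, antiOp A) 𝓘(ℝ, H →L[ℂ] H) ∞ (toOp : unitaryGp A → H →L[ℂ] H) := by
  intro G
  have hG : cayleyChart G G ∈ (cayleyChart G).target :=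
    (cayleyChart G).map_source (mem_cayleyChart_source G)
  rw [contMDiffAt_iff_source, modelWithCornersSelf_coe, Set.range_id, contMDiffWithinAt_univ,
    contMDiffAt_iff_contDiffAt]
  change ContDiffAt ℝ ∞ (fun X : antiOp A => toOp (G * cayleyInvGp A X)) (cayleyChart G G)
  have : ContDiffAt ℝ ∞ (fun X : antiOp A => toOp G * cayleyInv (X : H →L[ℂ] H))
      (cayleyChart G G) :=
    contDiffAt_const.mul (ContDiffAt.comp (cayleyChart G G) (contDiffAt_cayleyInv hG.1)
      (antiOp A).subtypeL.contDiff.contDiffAt)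
  refine this.congr_of_eventuallyEq ?_
  filter_upwards [(cayleyChart G).open_target.mem_nhds hG] with Y hY
  rw [← coe_cayleyInvGp hY.1 hY.2]; rfl

universe u

theorem contMDiff_of_toOp_comp {H : Type u} [NormedAddCommGroup H] [InnerProductSpace ℂ H]
    [CompleteSpace H] {A : H →L[ℂ] H} {E : Type u} [NormedAddCommGroup E] [NormedSpace ℝ E]
    {H' : Type*} [TopologicalSpace H'] {I : ModelWithCorners ℝ E H'} [I.Boundaryless]
    {M : Type*} [TopologicalSpace M] [ChartedSpace H' M] {f : M → unitaryGp A}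
    (h : ContMDiff I 𝓘(ℝ, H →L[ℂ] H) ∞ (fun x => toOp (f x))) :
    ContMDiff I 𝓘(ℝ, antiOp A) ∞ f := by
  intro x
  rw [contMDiffAt_iff_target]
  refine ⟨isEmbedding_toOp.continuousAt_iff.2 h.continuous.continuousAt, ?_⟩
  have hx := h x
  rw [contMDiffAt_iff_source, I.range_eq_univ, contMDiffWithinAt_univ,
    contMDiffAt_iff_contDiffAt] at hx ⊢
  refine contDiffAt_of_isometry_comp (antiOp A).subtypeₗᵢ ?_
  have hs : IsUnit (toOp ((f x)⁻¹) * toOp (f x) + 1) := mem_cayleyChart_source (f x)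
  have e : (extChartAt I x).symm (extChartAt I x x) = x := extChartAt_to_inv x
  refine ContDiffAt.comp (g := cayley)
    (f := fun y => toOp ((f x)⁻¹) * toOp (f ((extChartAt I x).symm y))) (extChartAt I x x) ?_
    (contDiffAt_const.mul hx)
  refine contDiffAt_cayley ?_
  simp only [e]
  exact hs

instance : LieGroup 𝓘(ℝ, antiOp A) ∞ (unitaryGp A) where
  contMDiff_mul := by
    refine contMDiff_of_toOp_comp ?_
    exact ContMDiff.comp (g := fun p : (H →L[ℂ] H) × (H →L[ℂ] H) => p.1 * p.2)
      (contMDiff_iff_contDiff.2 contDiff_mul)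
      ((contMDiff_toOp.comp contMDiff_fst).prodMk_space (contMDiff_toOp.comp contMDiff_snd))
  contMDiff_inv := by
    refine contMDiff_of_toOp_comp ?_
    intro G
    have h1 : ContMDiffAt 𝓘(ℝ, H →L[ℂ] H) 𝓘(ℝ, H →L[ℂ] H) ∞
        (Ring.inverse : (H →L[ℂ] H) → H →L[ℂ] H) (toOp G) :=
      (contDiffAt_inverse_op (Units.isUnit _)).contMDiffAt
    refine (h1.comp G (contMDiff_toOp G)).congr_of_eventuallyEq ?_
    exact Filter.Eventually.of_forall fun K => (Ring.inverse_unit (K : (H →L[ℂ] H)ˣ)).symm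

/-! ### The compatible Grassmannian and its orbits -/

/-- The compatible Grassmannian, as a subset of the real Banach space of `A`-symmetric operators:
an `A`-compatible subspace is identified with the unique `A`-symmetric idempotent having it as
its range. -/
def grassmannian (A : H →L[ℂ] H) : Set (symmOp A) := {Q | IsIdempotentElem (Q : H →L[ℂ] H)}

/-- The action `G · Q = G Q G⁻¹` of the `A`-unitary group on `A`-symmetric operators. -/
def conj (G : unitaryGp A) (Q : symmOp A) : symmOp A :=
  ⟨toOp G * (Q : H →L[ℂ] H) * toOp G⁻¹, fun f g => by
    have hG := fun f g => G.2 f g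
    have hi : ∀ x, toOp G (toOp G⁻¹ x) = x := fun x =>
      congrArg (fun T : H →L[ℂ] H => T x) (G : (H →L[ℂ] H)ˣ).mul_inv
    have hQ := Q.2 (toOp G⁻¹ f) (toOp G⁻¹ g)
    rw [← hG, ← hG (toOp G⁻¹ f)] at hQ
    change form A (toOp G _) (toOp G _) = form A (toOp G _) (toOp G _) at hQ
    rw [hi, hi] at hQ
    exact hQ⟩

/-- The orbit `{G Q₀ G⁻¹}` of `Q₀` under the `A`-unitary group. -/
def orbit (A : H →L[ℂ] H) (Q₀ : symmOp A) : Set (symmOp A) :=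
  Set.range fun G : unitaryGp A => conj G Q₀

/-- The map `G ↦ G Q₀ G⁻¹` from the `A`-unitary group onto the orbit of `Q₀`. -/
def orbitMap (A : H →L[ℂ] H) (Q₀ : symmOp A) (G : unitaryGp A) : orbit A Q₀ :=
  ⟨conj G Q₀, G, rfl⟩

end CompatGr
end

/-! Fix an `A`-symmetric idempotent `Q`. The commutator `comm Q` exchanges `A`-symmetric and
`A`-antisymmetric operators and satisfies `(comm Q)³ = comm Q` (`comm_comm_comm`). Hence `(comm Q)²`
is a bounded projection of the symmetric operators onto the codiagonal ones, `tangent Q`, and the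
kernel of this projection consists of the diagonal operators, those commuting with `Q`. The same
identity makes `toAnti Q` a bounded right inverse, on `tangent Q`, of `Z ↦ 2 (Z Q - Q Z)`, the
derivative of the orbit map in the Cayley chart. All complements are therefore explicit.

Split a symmetric `B` as `D + C` with `D` diagonal and `C` codiagonal, and let `unstraighten Q B` be
the conjugate of `Q + D` by the inverse Cayley transform of `toAnti Q B`. Its derivative at `0` is
the identity (`hasFDerivAt_unstraighten`), so it has a smooth local inverse. Conjugation preserves
idempotents, and for small `D` the operator `Q + D` is idempotent only if `D = 0`
(`eq_zero_of_isIdempotentElem_add`). So near `Q` the Grassmannian is the image of a piece of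
`tangent Q`, and that image consists of conjugates of `Q` (`exists_straightening`).

Everything follows from this. The Grassmannian is a split submanifold. Translating the
diffeomorphism by the group straightens the orbit at each of its points, always to the same `tangent
Q`. Each orbit is open in the Grassmannian, and since the orbits partition it, each is a union of
components. Finally, the lift of orbit points to the group given by `toAnti Q`, together with a
Cayley coordinate on the stabilizer, gives group charts in which the orbit map is a linear
projection (`isSubmersionAtOfComplement_of_stabilizer`). -/

noncomputable section

namespace CompatGr

universe u

/-! ### Embedded manifolds obtained from straightening diffeomorphisms -/

section Slices

variable {E : Type*} [NormedAddCommGroup E] [NormedSpace ℝ E]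

/-- The inverse function theorem, with an inverse that is smooth on its whole domain. -/
theorem exists_openPartialHomeomorph_of_hasFDerivAt_id [CompleteSpace E] {f : E → E} {s : Set E}
    {a : E} (hs : IsOpen s) (ha : a ∈ s) (hf : ContDiffOn ℝ ∞ f s)
    (hf' : HasFDerivAt f (ContinuousLinearMap.id ℝ E) a) :
    ∃ e : OpenPartialHomeomorph E E, a ∈ e.source ∧ e.source ⊆ s ∧ ⇑e = f ∧
      ContDiffOn ℝ ∞ e.symm e.target := by
  have hfa : ContDiffAt ℝ ∞ f a := hf.contDiffAt (hs.mem_nhds ha)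
  have hf'' : HasFDerivAt f ((ContinuousLinearEquiv.refl ℝ E : E ≃L[ℝ] E) : E →L[ℝ] E) a := hf'
  let e₀ := hfa.toOpenPartialHomeomorph f hf'' (by simp)
  -- The inverse function theorem gives smoothness of the inverse at `f a` only. Restricting to the
  -- open set where the derivative is invertible gives it at every point of the target.
  let t : Set E := s ∩ fderiv ℝ f ⁻¹' Set.range ((↑) : (E ≃L[ℝ] E) → E →L[ℝ] E)
  have ht : IsOpen t :=
    (hf.continuousOn_fderiv_of_isOpen hs (by simp)).isOpen_inter_preimage hs
      (ContinuousLinearEquiv.isOpen)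
  have hat : a ∈ t := ⟨ha, ⟨ContinuousLinearEquiv.refl ℝ E, hf''.fderiv.symm⟩⟩
  refine ⟨e₀.restrOpen t ht, ⟨hfa.mem_toOpenPartialHomeomorph_source hf'' (by simp), hat⟩,
    fun x hx => hx.2.1, rfl, fun y hy => ContDiffAt.contDiffWithinAt ?_⟩
  have hx := (e₀.restrOpen t ht).map_target hy
  obtain ⟨L, hL⟩ := hx.2.2
  have hfx : ContDiffAt ℝ ∞ f ((e₀.restrOpen t ht).symm y) :=
    hf.contDiffAt (hs.mem_nhds hx.2.1)
  refine (e₀.restrOpen t ht).contDiffAt_symm (f₀' := L) hy ?_ hfx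
  rw [hL]
  exact (hfx.differentiableAt (by simp)).hasFDerivAt

open Classical in
/-- The chart of `S` with values in `F` induced by a diffeomorphism straightening `S` to `F`. -/
def sliceChart (S : Set E) [Nonempty S] (F : Submodule ℝ E) (P : E →L[ℝ] F) (hP : ∀ x : F, P x = x)
    (φ : OpenPartialHomeomorph E E) (hφ : ∀ x ∈ φ.source, x ∈ S ↔ φ x ∈ F):
    OpenPartialHomeomorph S F where
  toFun s := P (φ s)
  -- The default value is never taken on the target, where `φ.symm y` lies in `S`.
  invFun y := if h : φ.symm y ∈ S then ⟨φ.symm y, h⟩ else Classical.arbitrary S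
  source := {s | (s : E) ∈ φ.source}
  target := {y | (y : E) ∈ φ.target}
  map_source' s hs := by
    have h := hP ⟨φ s, (hφ s hs).1 s.2⟩
    change P (φ s) = _ at h
    rw [h]
    exact φ.map_source hs
  map_target' y hy := by
    have h : φ.symm y ∈ S := (hφ _ (φ.map_target hy)).2 (by rw [φ.right_inv hy]; exact y.2)
    rw [dif_pos h]
    exact φ.map_target hy
  left_inv' s hs := by
    have h := hP ⟨φ s, (hφ s hs).1 s.2⟩
    change P (φ s) = _ at h
    simp only [h, φ.left_inv hs]
    rw [dif_pos s.2]
  right_inv' y hy := by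
    have h : φ.symm y ∈ S := (hφ _ (φ.map_target hy)).2 (by rw [φ.right_inv hy]; exact y.2)
    rw [dif_pos h, φ.right_inv hy, hP]
  open_source := φ.open_source.preimage continuous_subtype_val
  open_target := φ.open_target.preimage continuous_subtype_val
  continuousOn_toFun := P.continuous.comp_continuousOn
    (φ.continuousOn.comp continuous_subtype_val.continuousOn fun _ h => h)
  continuousOn_invFun := by
    refine (IsEmbedding.subtypeVal.continuousOn_iff).2 ?_
    refine (φ.continuousOn_symm.comp continuous_subtype_val.continuousOn fun _ h => h).congr
      fun y hy => ?_
    have h : φ.symm y ∈ S := (hφ _ (φ.map_target hy)).2 (by rw [φ.right_inv hy]; exact y.2)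
    simp only [Function.comp_apply]
    rw [dif_pos h]

variable {S : Set E} [Nonempty S] {ι : Type*} {F : Submodule ℝ E} {P : E →L[ℝ] F}
  {hP : ∀ x : F, P x = x}

theorem coe_sliceChart_symm {φ : OpenPartialHomeomorph E E}
    {hφ : ∀ x ∈ φ.source, x ∈ S ↔ φ x ∈ F} {y : F} (hy : (y : E) ∈ φ.target) :
    ((sliceChart S F P hP φ hφ).symm y : E) = φ.symm y := by
  have h : φ.symm y ∈ S := (hφ _ (φ.map_target hy)).2 (by rw [φ.right_inv hy]; exact y.2)
  classical
  change ((if h : φ.symm y ∈ S then ⟨φ.symm y, h⟩ else Classical.arbitrary S : S) : E) = _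
  rw [dif_pos h]

/-- A family of diffeomorphisms straightening `S` to the same subspace `F` makes `S` a manifold
modelled on `F`. -/
abbrev sliceChartedSpace (P : E →L[ℝ] F) (hP : ∀ x : F, P x = x)
    (φ : ι → OpenPartialHomeomorph E E)
    (hφ : ∀ p, ∀ x ∈ (φ p).source, x ∈ S ↔ φ p x ∈ F) (g : S → ι)
    (hg : ∀ p : S, (p : E) ∈ (φ (g p)).source) :
    ChartedSpace F S where
  atlas := Set.range fun p => sliceChart S F P hP (φ p) (hφ p)
  chartAt p := sliceChart S F P hP (φ (g p)) (hφ (g p))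
  mem_chart_source := hg
  chart_mem_atlas p := ⟨g p, rfl⟩

variable {φ : ι → OpenPartialHomeomorph E E}
    {hφ : ∀ p, ∀ x ∈ (φ p).source, x ∈ S ↔ φ p x ∈ F} {g : S → ι}
  {hg : ∀ p : S, (p : E) ∈ (φ (g p)).source}

/-- The transition maps are restrictions to `F` of `P ∘ φ q ∘ (φ p).symm`, hence smooth. -/
theorem isManifold_sliceChartedSpace
    (h1 : ∀ p, ContDiffOn ℝ ∞ (φ p) (φ p).source)
    (h2 : ∀ p, ContDiffOn ℝ ∞ (φ p).symm (φ p).target) :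
    letI := sliceChartedSpace P hP φ hφ g hg
    IsManifold 𝓘(ℝ, F) ∞ S := by
  let := sliceChartedSpace P hP φ hφ g hg
  refine isManifold_of_contDiffOn _ _ _ ?_
  rintro _ _ ⟨p, rfl⟩ ⟨q, rfl⟩
  simp only [modelWithCornersSelf_coe, modelWithCornersSelf_coe_symm, Function.id_comp,
    Function.comp_id, Set.preimage_id, Set.range_id, Set.inter_univ]
  have key : ∀ y ∈ ((sliceChart S F P hP (φ p) (hφ p)).symm ≫ₕ
      sliceChart S F P hP (φ q) (hφ q)).source,
      (y : E) ∈ (φ p).target ∧ (φ p).symm y ∈ (φ q).source := by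
    rintro y ⟨hy1, hy2⟩
    have hy2' : ((sliceChart S F P hP (φ p) (hφ p)).symm y : E) ∈ (φ q).source := hy2
    rw [coe_sliceChart_symm hy1] at hy2'
    exact ⟨hy1, hy2'⟩
  refine ContDiffOn.congr (f := fun y : F => P (φ q ((φ p).symm y))) ?_ fun y hy => ?_
  · refine P.contDiff.comp_contDiffOn ?_
    refine (h1 q).comp (t := (φ q).source)
      ((h2 p).comp F.subtypeL.contDiff.contDiffOn fun y hy => (key y hy).1)
      fun y hy => (key y hy).2
  · change P (φ q ((sliceChart S F P hP (φ p) (hφ p)).symm y : E)) = _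
    rw [coe_sliceChart_symm (key y hy).1]

/-- Read in a slice chart and in the diffeomorphism that induces it, the inclusion is `F ↪ E`, that
is `y ↦ (y, 0)` in the splitting of `E` as `F × P.ker`. -/
theorem isSmoothEmbedding_sliceChartedSpace
    (h1 : ∀ p, ContDiffOn ℝ ∞ (φ p) (φ p).source)
    (h2 : ∀ p, ContDiffOn ℝ ∞ (φ p).symm (φ p).target) :
    letI := sliceChartedSpace P hP φ hφ g hg
    Manifold.IsSmoothEmbedding 𝓘(ℝ, F) 𝓘(ℝ, E) ∞ (Subtype.val : S → E) := by
  let := sliceChartedSpace P hP φ hφ g hg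
  have : IsManifold 𝓘(ℝ, F) ∞ S := isManifold_sliceChartedSpace h1 h2
  refine ⟨⟨P.ker, inferInstance, inferInstance, fun p => ?_⟩, IsEmbedding.subtypeVal⟩
  refine Manifold.IsImmersionAtOfComplement.mk_of_charts
    (ContinuousLinearEquiv.equivOfRightInverse P F.subtypeL fun x => hP x).symm
    (sliceChart S F P hP (φ (g p)) (hφ (g p))) (φ (g p)) (hg p) (hg p)
    (IsManifold.subset_maximalAtlas ⟨g p, rfl⟩)
    ((φ (g p)).mem_maximalAtlas_of_contMDiffOn (h1 (g p)).contMDiffOn (h2 (g p)).contMDiffOn)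
    (fun x hx => hx) ?_
  intro y hy
  have hy' : (y : E) ∈ (φ (g p)).target := by
    rw [OpenPartialHomeomorph.extend_target] at hy
    exact hy.1
  simp only [modelWithCornersSelf_coe, Function.comp_apply,
    OpenPartialHomeomorph.extend_coe, OpenPartialHomeomorph.extend_coe_symm,
    modelWithCornersSelf_coe_symm, id_eq]
  rw [coe_sliceChart_symm hy', (φ (g p)).right_inv hy']
  exact (add_zero _).symm

theorem contMDiffOn_sliceChart_comp {V M : Type*} [NormedAddCommGroup V] [NormedSpace ℝ V]
    [TopologicalSpace M] [ChartedSpace V M] {f : M → S}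
    (hf : ContMDiff 𝓘(ℝ, V) 𝓘(ℝ, E) ∞ (fun x => (f x : E))) {i : ι}
    (h1 : ContDiffOn ℝ ∞ (φ i) (φ i).source) :
    ContMDiffOn 𝓘(ℝ, V) 𝓘(ℝ, F) ∞ (fun x => sliceChart S F P hP (φ i) (hφ i) (f x))
      (f ⁻¹' (sliceChart S F P hP (φ i) (hφ i)).source) := by
  have h : ContMDiffOn 𝓘(ℝ, V) 𝓘(ℝ, E) ∞ (fun x => φ i (f x))
      (f ⁻¹' (sliceChart S F P hP (φ i) (hφ i)).source) :=
    h1.contMDiffOn.comp hf.contMDiffOn fun x hx => hx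
  exact P.contMDiff.comp_contMDiffOn h

theorem sliceChart_mem_maximalAtlas (i : ι)
    (h1 : ∀ p, ContDiffOn ℝ ∞ (φ p) (φ p).source)
    (h2 : ∀ p, ContDiffOn ℝ ∞ (φ p).symm (φ p).target) :
    letI := sliceChartedSpace P hP φ hφ g hg
    sliceChart S F P hP (φ i) (hφ i) ∈ IsManifold.maximalAtlas 𝓘(ℝ, F) ∞ S := by
  let := sliceChartedSpace P hP φ hφ g hg
  have : IsManifold 𝓘(ℝ, F) ∞ S := isManifold_sliceChartedSpace h1 h2
  exact IsManifold.subset_maximalAtlas ⟨i, rfl⟩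

end Slices

/-! ### Submersions onto homogeneous spaces of a Lie group -/

section HomogeneousSpace

variable {V F : Type*} [NormedAddCommGroup V] [NormedSpace ℝ V] [NormedAddCommGroup F]
  [NormedSpace ℝ F] {𝓖 : Type*} [TopologicalSpace 𝓖] [ChartedSpace V 𝓖] [Group 𝓖]
  [LieGroup 𝓘(ℝ, V) ∞ 𝓖] {S : Type*} [TopologicalSpace S]

/-- Let `o` be the map of a Lie group onto a homogeneous space, and let `c` be a chart of the
group at `1` which carries the stabilizer to the kernel of the split surjection `p`. If the inverse
of the chart `e` of the homogeneous space lifts to the group through `c` and the section `X`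
of `p`, then `o` is a submersion. -/
theorem isSubmersionAtOfComplement_of_stabilizer [ChartedSpace F S] {o : 𝓖 → S}
    (ho : Continuous o) {c : OpenPartialHomeomorph 𝓖 V}
    (hc : ContMDiffOn 𝓘(ℝ, V) 𝓘(ℝ, V) ∞ c c.source)
    (hc' : ContMDiffOn 𝓘(ℝ, V) 𝓘(ℝ, V) ∞ c.symm c.target)
    (hinv : ∀ K ∈ c.source, K⁻¹ ∈ c.source) {p : V →L[ℝ] F} {X : F →L[ℝ] V}
    (hpX : ∀ y, p (X y) = y)
    (hstab : ∀ G K, o G = o K → K⁻¹ * G ∈ c.source → p (c (K⁻¹ * G)) = 0)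
    (hstab' : ∀ G, ∀ Z ∈ c.target, p Z = 0 → o (G * c.symm Z) = o G)
    {e : OpenPartialHomeomorph S F} (he : e ∈ IsManifold.maximalAtlas 𝓘(ℝ, F) ∞ S) {G : 𝓖}
    (hG : o G ∈ e.source)
    (heo : ContMDiffOn 𝓘(ℝ, V) 𝓘(ℝ, F) ∞ (fun K => e (o K)) (o ⁻¹' e.source))
    (h1 : ∀ y ∈ e.target, X y ∈ c.target)
    (h2 : ∀ y ∈ e.target, e.symm y = o (G * c.symm (X y))) :
    Manifold.IsSubmersionAtOfComplement p.ker 𝓘(ℝ, V) 𝓘(ℝ, F) ∞ o G := by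
  have : IsTopologicalGroup 𝓖 := topologicalGroup_of_lieGroup 𝓘(ℝ, V) ∞
  let U : Set 𝓖 := o ⁻¹' e.source
  have hU : IsOpen U := e.open_source.preimage ho
  -- `G * c.symm (r K)` is the lift of `o K` to the group, and `w K` is what remains of `K` after
  -- dividing by it. By `hstab` the coordinate `c (w K)` lies in `p.ker`, a complement of the range
  -- of `X`, which contains `r K`.
  let r : 𝓖 → V := fun K => X (e (o K))
  let w : 𝓖 → 𝓖 := fun K => (G * c.symm (r K))⁻¹ * K
  have hr : ∀ K ∈ U, r K ∈ c.target := fun K hK => h1 _ (e.map_source hK)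
  have hrs : ContMDiffOn 𝓘(ℝ, V) 𝓘(ℝ, V) ∞ r U := X.contMDiff.comp_contMDiffOn heo
  have hws : ContMDiffOn 𝓘(ℝ, V) 𝓘(ℝ, V) ∞ w U :=
    ((contMDiffOn_const.mul (hc'.comp hrs hr)).inv).mul contMDiffOn_id
  have hw : ∀ K ∈ U, o K = o (G * c.symm (r K)) := fun K hK => by
    rw [← h2 _ (e.map_source hK), e.left_inv hK]
  let s : Set 𝓖 := U ∩ w ⁻¹' c.source
  have hs : IsOpen s := hws.continuousOn.isOpen_inter_preimage hU c.open_source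
  let t : Set V := p ⁻¹' e.target ∩ {Z | Z - X (p Z) ∈ c.target}
  have ht : IsOpen t := (e.open_target.preimage p.continuous).inter
    (c.open_target.preimage (by fun_prop))
  have hproj : ∀ K ∈ s, p (r K + c (w K)) = e (o K) := fun K hK => by
    rw [map_add, hpX, hstab _ _ (hw K hK.1) hK.2, add_zero]
  let inv : V → 𝓖 := fun Z => G * c.symm (X (p Z)) * c.symm (Z - X (p Z))
  have horb : ∀ Z ∈ t, o (inv Z) = e.symm (p Z) := fun Z hZ => by
    rw [h2 _ hZ.1]
    exact hstab' _ _ hZ.2 (by rw [map_sub, hpX, sub_self])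
  have heT : ∀ Z ∈ t, e (o (inv Z)) = p Z := fun Z hZ => by
    rw [horb Z hZ, e.right_inv hZ.1]
  have hwT : ∀ Z ∈ t, w (inv Z) = c.symm (Z - X (p Z)) := fun Z hZ => by
    simp only [w, r, heT Z hZ, inv]
    group
  have hfwd : ContMDiffOn 𝓘(ℝ, V) 𝓘(ℝ, V) ∞ (fun K => r K + c (w K)) s :=
    (hrs.mono Set.inter_subset_left).add
      (hc.comp (hws.mono Set.inter_subset_left) fun K hK => hK.2)
  have hbwd : ContMDiffOn 𝓘(ℝ, V) 𝓘(ℝ, V) ∞ inv t :=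
    (contMDiffOn_const.mul (hc'.comp (X.comp p).contMDiff.contMDiffOn fun Z hZ => h1 _ hZ.1)).mul
      (hc'.comp (ContinuousLinearMap.id ℝ V - X.comp p).contMDiff.contMDiffOn fun Z hZ => hZ.2)
  -- This chart adds the coordinate along the section to the coordinate along the stabilizer; `p`
  -- recovers the former, so that `o` reads as `p` in the charts `ψ` and `e`.
  let ψ : OpenPartialHomeomorph 𝓖 V :=
    { toFun := fun K => r K + c (w K)
      invFun := inv
      source := s
      target := t
      map_source' := fun K hK => by
        simp only [t, Set.mem_inter_iff, Set.mem_preimage, Set.mem_ofPred_eq, hproj K hK]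
        refine ⟨e.map_source hK.1, ?_⟩
        rw [add_sub_cancel_left]
        exact c.map_source hK.2
      map_target' := fun Z hZ => by
        simp only [s, U, Set.mem_inter_iff, Set.mem_preimage, horb Z hZ, hwT Z hZ]
        exact ⟨e.map_target hZ.1, c.map_target hZ.2⟩
      left_inv' := fun K hK => by
        simp only [inv, hproj K hK]
        rw [add_sub_cancel_left, c.left_inv hK.2]
        exact mul_inv_cancel_left _ _
      right_inv' := fun Z hZ => by
        simp only [r, heT Z hZ, hwT Z hZ]
        rw [c.right_inv hZ.2, add_sub_cancel]
      open_source := hs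
      open_target := ht
      continuousOn_toFun := hfwd.continuousOn
      continuousOn_invFun := hbwd.continuousOn }
  have hψG : G ∈ ψ.source := by
    refine ⟨hG, ?_⟩
    -- `w G` is the inverse of `c.symm (r G)`, which is why the domain of `c` has to be stable under
    -- inversion.
    simp only [w, Set.mem_preimage, mul_inv_rev, inv_mul_cancel_right]
    exact hinv _ (c.map_target (hr G hG))
  have : IsManifold 𝓘(ℝ, V) ∞ 𝓖 := inferInstance
  refine Manifold.IsSubmersionAtOfComplement.mk_of_charts
    (ContinuousLinearEquiv.equivOfRightInverse p X hpX) ψ e hψG hG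
    (ψ.mem_maximalAtlas_of_contMDiffOn hfwd hbwd) he (fun K hK => hK.1) ?_
  intro Z hZ
  rw [OpenPartialHomeomorph.extend_target] at hZ
  exact heT Z hZ.1

/-- A homogeneous space `S` of a Lie group which sits in a normed space `E`, and which is
straightened near each point `o G` by a diffeomorphism `φ G` of `E` to a fixed subspace `F`, in such
a way that the inverse of `φ G` lifts to the group on `F`, is an embedded manifold onto which the
group submerses. -/
theorem exists_chartedSpace_isSubmersion {E : Type*} [NormedAddCommGroup E] [NormedSpace ℝ E]
    {S : Set E} {F : Submodule ℝ E} {o : 𝓖 → S} (ho : Function.Surjective o)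
    (ho' : ContMDiff 𝓘(ℝ, V) 𝓘(ℝ, E) ∞ (fun G => (o G : E))) {c : OpenPartialHomeomorph 𝓖 V}
    (hc : ContMDiffOn 𝓘(ℝ, V) 𝓘(ℝ, V) ∞ c c.source)
    (hc' : ContMDiffOn 𝓘(ℝ, V) 𝓘(ℝ, V) ∞ c.symm c.target)
    (hinv : ∀ K ∈ c.source, K⁻¹ ∈ c.source) {p : V →L[ℝ] F} {X : E →L[ℝ] V} {P : E →L[ℝ] F}
    (hP : ∀ y : F, P y = y) (hpX : ∀ y : F, p (X y) = y)
    (hstab : ∀ G K, o G = o K → K⁻¹ * G ∈ c.source → p (c (K⁻¹ * G)) = 0)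
    (hstab' : ∀ G, ∀ Z ∈ c.target, p Z = 0 → o (G * c.symm Z) = o G)
    {φ : 𝓖 → OpenPartialHomeomorph E E} (h0 : ∀ G, (o G : E) ∈ (φ G).source)
    (h1 : ∀ G, ContDiffOn ℝ ∞ (φ G) (φ G).source)
    (h2 : ∀ G, ContDiffOn ℝ ∞ (φ G).symm (φ G).target)
    (h3 : ∀ G, ∀ x ∈ (φ G).source, x ∈ S ↔ φ G x ∈ F)
    (h4 : ∀ G, ∀ y ∈ (φ G).target, X y ∈ c.target)
    (h5 : ∀ G, ∀ y ∈ (φ G).target, y ∈ F → (φ G).symm y = o (G * c.symm (X y))) :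
    ∃ (_ : ChartedSpace F S), IsManifold 𝓘(ℝ, F) ∞ S ∧
      Manifold.IsSmoothEmbedding 𝓘(ℝ, F) 𝓘(ℝ, E) ∞ (Subtype.val : S → E) ∧
      Manifold.IsSubmersion 𝓘(ℝ, V) 𝓘(ℝ, F) ∞ o := by
  have : Nonempty S := ⟨o 1⟩
  have hg : ∀ p : S, (p : E) ∈ (φ (Function.surjInv ho p)).source := fun p => by
    have h := h0 (Function.surjInv ho p)
    rwa [Function.surjInv_eq ho p] at h
  let := sliceChartedSpace P hP φ h3 (Function.surjInv ho) hg
  exact ⟨this, isManifold_sliceChartedSpace h1 h2, isSmoothEmbedding_sliceChartedSpace h1 h2,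
    p.ker, inferInstance, inferInstance, fun G =>
      isSubmersionAtOfComplement_of_stabilizer (X := X.comp F.subtypeL)
        (ho'.continuous.subtype_mk _) hc hc' hinv hpX hstab hstab'
        (sliceChart_mem_maximalAtlas G h1 h2) (h0 G) (contMDiffOn_sliceChart_comp ho' (h1 G))
        (fun y hy => h4 G y hy)
        (fun y hy => Subtype.ext ((coe_sliceChart_symm hy).trans (h5 G y hy y.2)))⟩

end HomogeneousSpace

variable {H : Type*} [NormedAddCommGroup H] [InnerProductSpace ℂ H] [CompleteSpace H]
  {A : H →L[ℂ] H}

/-! ### Commutators with a symmetric operator -/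

/-- The commutator `T ↦ T Q - Q T`. -/
def comm (Q : H →L[ℂ] H) : (H →L[ℂ] H) →L[ℝ] (H →L[ℂ] H) :=
  (ContinuousLinearMap.mul ℝ (H →L[ℂ] H)).flip Q - ContinuousLinearMap.mul ℝ (H →L[ℂ] H) Q

theorem comm_apply (Q T : H →L[ℂ] H) : comm Q T = T * Q - Q * T := rfl

/-- In block form relative to `Q`, the commutator kills the diagonal blocks and acts by `1` and `-1`
on the two off-diagonal ones, so it equals its own cube. -/
theorem comm_comm_comm {Q : H →L[ℂ] H} (hQ : IsIdempotentElem Q) (T : H →L[ℂ] H) :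
    comm Q (comm Q (comm Q T)) = comm Q T := by
  have hQ' : Q * Q = Q := hQ
  have h : ∀ S : H →L[ℂ] H, Q * (Q * S) = Q * S := fun S => by rw [← mul_assoc, hQ']
  simp only [comm_apply, sub_mul, mul_sub, mul_assoc, hQ', h]
  abel

theorem comm_symm_mem {Q B : H →L[ℂ] H} (hQ : Q ∈ symmOp A) (hB : B ∈ symmOp A) :
    comm Q B ∈ antiOp A := by
  rw [mem_symmOp] at hQ hB
  rw [mem_antiOp, comm_apply, star_sub, star_mul, star_mul, sub_mul, mul_assoc, mul_assoc, hQ, hB,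
    ← mul_assoc, ← mul_assoc, hQ, hB, mul_sub]
  simp only [mul_assoc]
  abel

theorem comm_anti_mem {Q Z : H →L[ℂ] H} (hQ : Q ∈ symmOp A) (hZ : Z ∈ antiOp A) :
    comm Q Z ∈ symmOp A := by
  rw [mem_symmOp] at hQ ⊢
  rw [mem_antiOp] at hZ
  rw [comm_apply, star_sub, star_mul, star_mul, sub_mul, mul_assoc, mul_assoc, hQ, hZ,
    mul_neg, ← mul_assoc, ← mul_assoc, hQ, hZ, mul_sub]
  simp only [mul_assoc, neg_mul]
  abel

/-- The map `B ↦ (B Q - Q B) / 2` from symmetric to antisymmetric operators. -/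
def toAnti (Q : symmOp A) : symmOp A →L[ℝ] antiOp A :=
  (((2 : ℝ)⁻¹ • comm (Q : H →L[ℂ] H)).comp (symmOp A).subtypeL).codRestrict (antiOp A)
    fun B => (antiOp A).smul_mem _ (comm_symm_mem Q.2 B.2)

/-- The map `Z ↦ 2 (Z Q - Q Z)` from antisymmetric to symmetric operators. -/
def toSymm (Q : symmOp A) : antiOp A →L[ℝ] symmOp A :=
  (((2 : ℝ) • comm (Q : H →L[ℂ] H)).comp (antiOp A).subtypeL).codRestrict (symmOp A)
    fun Z => (symmOp A).smul_mem _ (comm_anti_mem Q.2 Z.2)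

theorem coe_toAnti (Q B : symmOp A) :
    (toAnti Q B : H →L[ℂ] H) = (2 : ℝ)⁻¹ • comm (Q : H →L[ℂ] H) B := rfl

theorem coe_toSymm (Q : symmOp A) (Z : antiOp A) :
    (toSymm Q Z : H →L[ℂ] H) = (2 : ℝ) • comm (Q : H →L[ℂ] H) Z := rfl

/-- The factor `2` in `toSymm` is the derivative of the inverse Cayley transform at `0`; the factor
`1/2` in `toAnti` compensates it, so the composite is the projection onto codiagonal operators. -/
theorem coe_toSymm_toAnti (Q B : symmOp A) :
    (toSymm Q (toAnti Q B) : H →L[ℂ] H) = comm (Q : H →L[ℂ] H) (comm (Q : H →L[ℂ] H) B) := by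
  rw [coe_toSymm, coe_toAnti, map_smul, smul_smul, mul_inv_cancel₀ two_ne_zero, one_smul]

variable {Q : symmOp A}

theorem toSymm_toAnti_toSymm (hQ : Q ∈ grassmannian A) (Z : antiOp A) :
    toSymm Q (toAnti Q (toSymm Q Z)) = toSymm Q Z :=
  Subtype.ext (by
    rw [coe_toSymm_toAnti, coe_toSymm, map_smul, map_smul, comm_comm_comm hQ])

/-- The tangent space at `Q` to the Grassmannian: the symmetric operators which are codiagonal
with respect to `Q`. -/
def tangent (Q : symmOp A) : Submodule ℝ (symmOp A) :=
  (ContinuousLinearMap.id ℝ (symmOp A) - (toSymm Q).comp (toAnti Q)).ker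

theorem mem_tangent {B : symmOp A} : B ∈ tangent Q ↔ toSymm Q (toAnti Q B) = B := by
  rw [tangent, LinearMap.mem_ker]
  change B - toSymm Q (toAnti Q B) = 0 ↔ _
  rw [sub_eq_zero, eq_comm]

/-- The derivative at `1` of the orbit map read in the Cayley chart, `Z ↦ 2 (Z Q - Q Z)`. -/
def toTangent (hQ : Q ∈ grassmannian A) : antiOp A →L[ℝ] tangent Q :=
  (toSymm Q).codRestrict (tangent Q) fun Z => mem_tangent.2 (toSymm_toAnti_toSymm hQ Z)

/-- The projection of symmetric operators onto their codiagonal part. -/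
def tangentProj (hQ : Q ∈ grassmannian A) : symmOp A →L[ℝ] tangent Q :=
  (toTangent hQ).comp (toAnti Q)

theorem tangentProj_coe (hQ : Q ∈ grassmannian A) (y : tangent Q) : tangentProj hQ y = y :=
  Subtype.ext (mem_tangent.1 y.2)

theorem toTangent_toAnti (hQ : Q ∈ grassmannian A) (y : tangent Q) :
    toTangent hQ (toAnti Q y) = y := tangentProj_coe hQ y

/-- The kernel is the Lie algebra of the stabilizer of `Q`. -/
theorem mem_ker_toTangent {hQ : Q ∈ grassmannian A} {Z : antiOp A} :
    Z ∈ (toTangent hQ).ker ↔ (Z : H →L[ℂ] H) * Q = Q * Z := by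
  rw [LinearMap.mem_ker, ← sub_eq_zero (a := (Z : H →L[ℂ] H) * Q), ← comm_apply]
  constructor
  · intro h
    have h' : (2 : ℝ) • comm (Q : H →L[ℂ] H) (Z : H →L[ℂ] H) = 0 := by
      rw [← coe_toSymm]
      exact congrArg (fun y : tangent Q => ((y : symmOp A) : H →L[ℂ] H)) h
    exact (smul_eq_zero.1 h').resolve_left two_ne_zero
  · intro h
    refine Subtype.ext (Subtype.ext ?_)
    change (2 : ℝ) • comm (Q : H →L[ℂ] H) (Z : H →L[ℂ] H) = 0
    rw [h, smul_zero]

/-! ### The action of the group of `A`-unitary operators -/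

theorem toOp_mul (G K : unitaryGp A) : toOp (G * K) = toOp G * toOp K := rfl

theorem toOp_one : toOp (1 : unitaryGp A) = 1 := rfl

theorem toOp_inv_mul (G : unitaryGp A) : toOp G⁻¹ * toOp G = 1 := by
  rw [← toOp_mul, inv_mul_cancel, toOp_one]

theorem toOp_mul_inv (G : unitaryGp A) : toOp G * toOp G⁻¹ = 1 := by
  rw [← toOp_mul, mul_inv_cancel, toOp_one]

theorem coe_conj (G : unitaryGp A) (B : symmOp A) :
    (conj G B : H →L[ℂ] H) = toOp G * (B : H →L[ℂ] H) * toOp G⁻¹ := rfl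

theorem conj_one (B : symmOp A) : conj 1 B = B :=
  Subtype.ext (by rw [coe_conj, inv_one, toOp_one, one_mul, mul_one])

theorem conj_mul (G K : unitaryGp A) (B : symmOp A) : conj (G * K) B = conj G (conj K B) :=
  Subtype.ext (by simp only [coe_conj, mul_inv_rev, toOp_mul, mul_assoc])

theorem conj_inv_conj (G : unitaryGp A) (B : symmOp A) : conj G⁻¹ (conj G B) = B := by
  rw [← conj_mul, inv_mul_cancel, conj_one]

theorem conj_conj_inv (G : unitaryGp A) (B : symmOp A) : conj G (conj G⁻¹ B) = B := by
  rw [← conj_mul, mul_inv_cancel, conj_one]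

theorem conj_eq_self_iff {G : unitaryGp A} {B : symmOp A} :
    conj G B = B ↔ toOp G * (B : H →L[ℂ] H) = B * toOp G := by
  rw [Subtype.ext_iff, coe_conj]
  constructor
  · intro h
    have := congrArg (· * toOp G) h
    simpa only [mul_assoc, toOp_inv_mul, mul_one] using this
  · intro h
    rw [h, mul_assoc, toOp_mul_inv, mul_one]

theorem conj_mem_grassmannian {G : unitaryGp A} {B : symmOp A} :
    conj G B ∈ grassmannian A ↔ B ∈ grassmannian A := by
  have key : ∀ (G : unitaryGp A) {B : symmOp A}, B ∈ grassmannian A →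
      conj G B ∈ grassmannian A := by
    intro G B hB
    have hB' : (B : H →L[ℂ] H) * B = B := hB
    change (conj G B : H →L[ℂ] H) * conj G B = conj G B
    calc (conj G B : H →L[ℂ] H) * conj G B
        = toOp G * (B : H →L[ℂ] H) * (toOp G⁻¹ * toOp G) * B * toOp G⁻¹ := by
          simp only [coe_conj, mul_assoc]
      _ = conj G B := by rw [toOp_inv_mul, mul_one, mul_assoc (toOp G), hB', coe_conj]
  refine ⟨fun h => ?_, key G⟩
  rw [← conj_inv_conj G B]
  exact key _ h

theorem orbit_subset_grassmannian (hQ : Q ∈ grassmannian A) : orbit A Q ⊆ grassmannian A := by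
  rintro _ ⟨G, rfl⟩
  exact conj_mem_grassmannian.2 hQ

theorem conj_mem_orbit {G : unitaryGp A} {B : symmOp A} :
    conj G B ∈ orbit A Q ↔ B ∈ orbit A Q := by
  constructor
  · rintro ⟨K, hK⟩
    exact ⟨G⁻¹ * K, by simp only [conj_mul] at hK ⊢; rw [hK, conj_inv_conj]⟩
  · rintro ⟨K, rfl⟩
    exact ⟨G * K, conj_mul G K Q⟩

theorem mem_orbit_self : Q ∈ orbit A Q := ⟨1, conj_one Q⟩

theorem orbit_eq_of_mem {B : symmOp A} (hB : B ∈ orbit A Q) : orbit A B = orbit A Q := by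
  obtain ⟨G, rfl⟩ := hB
  ext C
  constructor
  · rintro ⟨K, rfl⟩
    exact ⟨K * G, conj_mul K G Q⟩
  · rintro ⟨K, rfl⟩
    exact ⟨K * G⁻¹, by simp only [conj_mul, conj_inv_conj]⟩

theorem contDiff_conj (G : unitaryGp A) : ContDiff ℝ ∞ (conj G) :=
  contDiffOn_univ.1 <| contDiffOn_of_isometry_comp (symmOp A).subtypeₗᵢ isOpen_univ <| by
    change ContDiffOn ℝ ∞ (fun B : symmOp A => toOp G * (B : H →L[ℂ] H) * toOp G⁻¹) _
    exact ((contDiff_const.mul (symmOp A).subtypeL.contDiff).mul contDiff_const).contDiffOn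

/-- Conjugation by an `A`-unitary operator, as a homeomorphism. -/
def conjHomeomorph (G : unitaryGp A) : symmOp A ≃ₜ symmOp A where
  toFun := conj G
  invFun := conj G⁻¹
  left_inv := conj_inv_conj G
  right_inv := conj_conj_inv G
  continuous_toFun := (contDiff_conj G).continuous
  continuous_invFun := (contDiff_conj G⁻¹).continuous

/-! ### Straightening the Grassmannian -/

theorem cayleyInv_neg_mul {R : Type*} [Ring R] {X : R} (h : IsUnit (1 - X)) (h' : IsUnit (1 + X)) :
    cayleyInv (-X) * cayleyInv X = 1 := by
  rw [cayleyInv, cayleyInv, sub_neg_eq_add, ← sub_eq_add_neg, mul_assoc,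
    Ring.inverse_mul_cancel_left _ _ h', Ring.mul_inverse_cancel _ h]

theorem toOp_inv_cayleyInvGp {X : antiOp A} (h : IsUnit (1 - (X : H →L[ℂ] H)))
    (h' : IsUnit (1 + (X : H →L[ℂ] H))) :
    toOp (cayleyInvGp A X)⁻¹ = cayleyInv (-(X : H →L[ℂ] H)) := by
  have e := toOp_mul_inv (cayleyInvGp A X)
  have e' : toOp (cayleyInvGp A X) = cayleyInv (X : H →L[ℂ] H) := coe_cayleyInvGp h h'
  rw [e'] at e
  calc toOp (cayleyInvGp A X)⁻¹
      = cayleyInv (-(X : H →L[ℂ] H)) * (cayleyInv (X : H →L[ℂ] H) * toOp (cayleyInvGp A X)⁻¹) := by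
        rw [← mul_assoc, cayleyInv_neg_mul h h', one_mul]
    _ = _ := by rw [e, mul_one]

/-- To first order, `(1 + X) (1 - X)⁻¹ = 1 + 2 X`. -/
theorem hasFDerivAt_cayleyInv_zero {R : Type*} [NormedRing R] [NormedAlgebra ℝ R]
    [CompleteSpace R] :
    HasFDerivAt (cayleyInv : R → R) ((2 : ℝ) • ContinuousLinearMap.id ℝ R) 0 := by
  have h1 : HasFDerivAt (fun X : R => 1 - X) (-ContinuousLinearMap.id ℝ R) 0 :=
    (hasFDerivAt_id _).const_sub 1
  have h2 : HasFDerivAt (fun X : R => 1 + X) (ContinuousLinearMap.id ℝ R) 0 :=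
    (hasFDerivAt_id _).const_add 1
  have h3 : HasFDerivAt Ring.inverse (-ContinuousLinearMap.mulLeftRight ℝ R 1 1) (1 - 0 : R) := by
    simpa using hasFDerivAt_ringInverse (𝕜 := ℝ) (1 : Rˣ)
  refine (h2.mul' (h3.comp 0 h1)).congr_fderiv ?_
  ext1 X
  simp [two_smul]

/-- Product rule: at `0` the three factors are `1`, `q`, `1`, with derivatives `2 ℓ`, `m`, `-2 ℓ`.
-/
theorem hasFDerivAt_cayleyInv_mul_mul {E R : Type*} [NormedAddCommGroup E] [NormedSpace ℝ E]
    [NormedRing R] [NormedAlgebra ℝ R] [CompleteSpace R] (ℓ m : E →L[ℝ] R) (q : R) :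
    HasFDerivAt (fun B => cayleyInv (ℓ B) * (q + m B) * cayleyInv (-ℓ B))
      (m + (2 : ℝ) • ((ContinuousLinearMap.mul ℝ R).flip q - ContinuousLinearMap.mul ℝ R q).comp ℓ)
      0 := by
  have h1 : HasFDerivAt (fun B => cayleyInv (ℓ B)) _ 0 :=
    HasFDerivAt.comp (g := cayleyInv) 0 (by simpa using hasFDerivAt_cayleyInv_zero)
      ℓ.hasFDerivAt
  have h2 : HasFDerivAt (fun B => cayleyInv (-ℓ B)) _ 0 :=
    HasFDerivAt.comp (g := cayleyInv) 0 (by simpa using hasFDerivAt_cayleyInv_zero)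
      ℓ.hasFDerivAt.neg
  refine ((h1.mul' (m.hasFDerivAt.const_add q)).mul' h2).congr_fderiv ?_
  ext1 B
  simp [cayleyInv, smul_sub]
  abel

section Straightening

variable (Q)

/-- The map whose inverse straightens the Grassmannian near `Q`: it moves `Q + D`, for the diagonal
part `D` of `B`, by the `A`-unitary operator determined by the codiagonal part of `B`. -/
def unstraighten (B : symmOp A) : symmOp A :=
  conj (cayleyInvGp A (toAnti Q B)) (Q + (B - toSymm Q (toAnti Q B)))

theorem coe_unstraighten {B : symmOp A} (h : toAnti Q B ∈ (cayleyChart (1 : unitaryGp A)).target) :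
    (unstraighten Q B : H →L[ℂ] H) = cayleyInv (toAnti Q B : H →L[ℂ] H) *
      ((Q + (B - toSymm Q (toAnti Q B)) : symmOp A) : H →L[ℂ] H) *
        cayleyInv (-(toAnti Q B : H →L[ℂ] H)) := by
  have e : toOp (cayleyInvGp A (toAnti Q B)) = _ := coe_cayleyInvGp h.1 h.2
  rw [unstraighten, coe_conj, toOp_inv_cayleyInvGp h.1 h.2, e]

theorem isOpen_preimage_toAnti :
    IsOpen {B : symmOp A | toAnti Q B ∈ (cayleyChart (1 : unitaryGp A)).target} :=
  (cayleyChart (1 : unitaryGp A)).open_target.preimage (toAnti Q).continuous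

theorem contDiffOn_unstraighten :
    ContDiffOn ℝ ∞ (unstraighten Q)
      {B : symmOp A | toAnti Q B ∈ (cayleyChart (1 : unitaryGp A)).target} := by
  refine contDiffOn_of_isometry_comp (symmOp A).subtypeₗᵢ (isOpen_preimage_toAnti Q) ?_
  refine ContDiffOn.congr (fun B hB => ContDiffAt.contDiffWithinAt ?_)
    fun B hB => coe_unstraighten Q hB
  have h1 : ContDiffAt ℝ ∞ (fun B : symmOp A => (toAnti Q B : H →L[ℂ] H)) B :=
    ((antiOp A).subtypeL.contDiff.comp (toAnti Q).contDiff).contDiffAt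
  refine ContDiffAt.mul (ContDiffAt.mul ?_ ?_) ?_
  · exact ContDiffAt.comp (g := cayleyInv) B (contDiffAt_cayleyInv hB.1) h1
  · have h2 : ContDiff ℝ ∞ (fun B : symmOp A => Q + (B - toSymm Q (toAnti Q B))) :=
      contDiff_const.add (contDiff_id.sub ((toSymm Q).contDiff.comp (toAnti Q).contDiff))
    exact ((symmOp A).subtypeL.contDiff.comp h2).contDiffAt
  · refine ContDiffAt.comp (g := cayleyInv) (f := fun B : symmOp A => -(toAnti Q B : H →L[ℂ] H)) B
      (contDiffAt_cayleyInv ?_) h1.neg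
    rw [sub_neg_eq_add]
    exact hB.2

theorem zero_mem_cayleyChart_target : (0 : antiOp A) ∈ (cayleyChart (1 : unitaryGp A)).target := by
  constructor <;> simp

theorem unstraighten_zero : unstraighten Q 0 = Q := by
  have h : toAnti Q (0 : symmOp A) ∈ (cayleyChart (1 : unitaryGp A)).target := by
    rw [map_zero]; exact zero_mem_cayleyChart_target
  refine Subtype.ext ?_
  rw [coe_unstraighten Q h]
  simp [cayleyInv]

/-- The middle factor contributes the diagonal part of `B` and the two outer factors its codiagonal
part, and these add up to `B`. -/
theorem hasFDerivAt_unstraighten :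
    HasFDerivAt (unstraighten Q) (ContinuousLinearMap.id ℝ (symmOp A)) 0 := by
  have h0 : (0 : symmOp A) ∈ {B | toAnti Q B ∈ (cayleyChart (1 : unitaryGp A)).target} := by
    change toAnti Q 0 ∈ (cayleyChart (1 : unitaryGp A)).target
    rw [map_zero]; exact zero_mem_cayleyChart_target
  have h5 : HasFDerivAt (fun B => (symmOp A).subtypeₗᵢ (unstraighten Q B)) _ 0 :=
    (hasFDerivAt_cayleyInv_mul_mul ((antiOp A).subtypeL.comp (toAnti Q)) ((symmOp A).subtypeL.comp
      (ContinuousLinearMap.id ℝ (symmOp A) - (toSymm Q).comp (toAnti Q)))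
      (Q : H →L[ℂ] H)).congr_of_eventuallyEq
    (Filter.eventually_of_mem ((isOpen_preimage_toAnti Q).mem_nhds h0)
      fun B hB => coe_unstraighten Q hB)
  -- The derivative is computed among all bounded operators; it descends to the closed subspace of
  -- symmetric ones and is identified there by uniqueness.
  obtain ⟨L', hL'⟩ := hasFDerivAt_of_isometry_comp (symmOp A).subtypeₗᵢ h5
  have e := ((symmOp A).subtypeL.hasFDerivAt.comp 0 hL').unique h5
  refine hL'.congr_fderiv (ContinuousLinearMap.ext fun B => Subtype.ext ?_)
  refine (DFunLike.congr_fun e B).trans ?_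
  change ((B - toSymm Q (toAnti Q B) : symmOp A) : H →L[ℂ] H)
    + (2 : ℝ) • comm (Q : H →L[ℂ] H) (toAnti Q B : H →L[ℂ] H) = B
  rw [← coe_toSymm, Submodule.coe_sub, sub_add_cancel]

variable {Q}

/-- Expanding `(q + d)² = q + d` with `d` and `q` commuting gives `d (d + 2 q - 1) = 0`. The second
factor is invertible for `d` near `0`, because `2 q - 1` is an involution. -/
theorem eq_zero_of_isIdempotentElem_add {R : Type*} [Ring R] {q d : R} (hq : IsIdempotentElem q)
    (hqd : d * q = q * d) (h : IsIdempotentElem (q + d)) (hu : IsUnit (d + (2 * q - 1))) :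
    d = 0 := by
  have h' : (q + d) * (q + d) = q + d := h
  have hq' : q * q = q := hq
  refine (hu.mul_left_eq_zero).1 ?_
  have : d * (d + (2 * q - 1)) = (q + d) * (q + d) - q * q - d := by
    simp only [mul_add, add_mul, mul_sub, mul_one, two_mul, hqd]
    abel
  rw [this, h', hq']
  abel

theorem isUnit_two_mul_sub_one {R : Type*} [Ring R] {q : R} (hq : IsIdempotentElem q) :
    IsUnit (2 * q - 1) := by
  have hq' : q * q = q := hq
  have : (2 * q - 1) * (2 * q - 1) = 1 := by
    simp only [two_mul, mul_sub, sub_mul, mul_add, add_mul, hq', mul_one, one_mul]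
    abel
  exact ⟨⟨_, _, this, this⟩, rfl⟩

/-- Conjugation does not affect idempotency, so only `Q + D` matters, where `D` is the diagonal part
of `B`. -/
theorem unstraighten_mem_grassmannian (hQ : Q ∈ grassmannian A) {B : symmOp A}
    (hu : IsUnit (((B - toSymm Q (toAnti Q B) : symmOp A) : H →L[ℂ] H)
      + (2 * (Q : H →L[ℂ] H) - 1))) :
    unstraighten Q B ∈ grassmannian A ↔ B ∈ tangent Q := by
  rw [unstraighten, conj_mem_grassmannian, mem_tangent]
  constructor
  · intro h
    have hD : ((B - toSymm Q (toAnti Q B) : symmOp A) : H →L[ℂ] H) = 0 := by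
      refine eq_zero_of_isIdempotentElem_add hQ ?_ h hu
      rw [← sub_eq_zero, ← comm_apply, Submodule.coe_sub, map_sub, coe_toSymm_toAnti,
        comm_comm_comm hQ, sub_self]
    exact (sub_eq_zero.1 (Subtype.ext hD)).symm
  · intro h
    rwa [h, sub_self, add_zero]

/-- Near each of its points, the Grassmannian is straightened by a diffeomorphism which carries it
to the tangent space, and whose inverse on the tangent space is given by the orbit map. -/
theorem exists_straightening (hQ : Q ∈ grassmannian A) :
    ∃ φ : OpenPartialHomeomorph (symmOp A) (symmOp A), Q ∈ φ.source ∧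
      ContDiffOn ℝ ∞ φ φ.source ∧ ContDiffOn ℝ ∞ φ.symm φ.target ∧
      (∀ x ∈ φ.source, x ∈ grassmannian A ↔ φ x ∈ tangent Q) ∧
      ∀ B ∈ φ.target, toAnti Q B ∈ (cayleyChart (1 : unitaryGp A)).target ∧
        (B ∈ tangent Q → φ.symm B = conj (cayleyInvGp A (toAnti Q B)) Q) := by
  -- On the first set the Cayley parametrization takes no default value; on the second an idempotent
  -- `Q + D` must have `D = 0`.
  let s : Set (symmOp A) := {B | toAnti Q B ∈ (cayleyChart (1 : unitaryGp A)).target} ∩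
    {B | IsUnit (((B - toSymm Q (toAnti Q B) : symmOp A) : H →L[ℂ] H)
      + (2 * (Q : H →L[ℂ] H) - 1))}
  have hs : IsOpen s := by
    refine (isOpen_preimage_toAnti Q).inter (Units.isOpen.preimage ?_)
    fun_prop
  have h0 : (0 : symmOp A) ∈ s := by
    refine ⟨?_, ?_⟩
    · change toAnti Q 0 ∈ (cayleyChart (1 : unitaryGp A)).target
      rw [map_zero]; exact zero_mem_cayleyChart_target
    · change IsUnit _
      simpa using isUnit_two_mul_sub_one hQ
  have hc : ContDiffOn ℝ ∞ (unstraighten Q) s :=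
    (contDiffOn_unstraighten Q).mono Set.inter_subset_left
  obtain ⟨e, he0, hes, hef, hec⟩ := exists_openPartialHomeomorph_of_hasFDerivAt_id hs h0 hc
    (hasFDerivAt_unstraighten Q)
  refine ⟨e.symm, ?_, hec, ?_, ?_, ?_⟩
  · rw [← unstraighten_zero Q, ← hef]
    exact e.map_source he0
  · rw [e.symm_symm, hef]
    exact hc.mono hes
  · intro x hx
    rw [← unstraighten_mem_grassmannian hQ (hes (e.map_target hx)).2, ← hef, e.right_inv hx]
  · intro B hB
    refine ⟨(hes hB).1, fun hB' => ?_⟩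
    rw [e.symm_symm, hef, unstraighten, mem_tangent.1 hB', sub_self, add_zero]

end Straightening

/-- A map into a closed subspace is `C^∞` when it is `C^∞` into the ambient space. -/
theorem contMDiff_of_isometry_comp {E F G : Type u} [NormedAddCommGroup E] [NormedSpace ℝ E]
    [NormedAddCommGroup F] [NormedSpace ℝ F] [NormedAddCommGroup G] [NormedSpace ℝ G]
    [CompleteSpace F] (ι : F →ₗᵢ[ℝ] G) {H' : Type*} [TopologicalSpace H']
    {I : ModelWithCorners ℝ E H'} [I.Boundaryless] {M : Type*} [TopologicalSpace M]
    [ChartedSpace H' M] {f : M → F} (h : ContMDiff I 𝓘(ℝ, G) ∞ (fun x => ι (f x))) :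
    ContMDiff I 𝓘(ℝ, F) ∞ f := by
  intro x
  have hx := h x
  rw [contMDiffAt_iff_source, I.range_eq_univ, contMDiffWithinAt_univ,
    contMDiffAt_iff_contDiffAt] at hx ⊢
  exact contDiffAt_of_isometry_comp ι hx

theorem contMDiff_conj (Q : symmOp A) :
    ContMDiff 𝓘(ℝ, antiOp A) 𝓘(ℝ, symmOp A) ∞ (fun G : unitaryGp A => conj G Q) := by
  refine contMDiff_of_isometry_comp (symmOp A).subtypeₗᵢ ?_
  have h := ContMDiff.comp
    (g := fun p : (H →L[ℂ] H) × (H →L[ℂ] H) => p.1 * (Q : H →L[ℂ] H) * p.2)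
    (contMDiff_iff_contDiff.2 ((contDiff_fst.mul contDiff_const).mul contDiff_snd))
    ((contMDiff_toOp (A := A)).prodMk_space (contMDiff_toOp.comp (contMDiff_inv 𝓘(ℝ, antiOp A) ∞)))
  exact h

/-! ### The slice charts of the orbit -/

/-- The orbit of `Q` is straightened near each of its points by diffeomorphisms which carry it
to the tangent space at `Q`, and whose inverses are given by the orbit map. -/
theorem exists_orbit_straightening (hQ : Q ∈ grassmannian A) :
    ∃ φ : unitaryGp A → OpenPartialHomeomorph (symmOp A) (symmOp A), ∀ G,
      conj G Q ∈ (φ G).source ∧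
      ContDiffOn ℝ ∞ (φ G) (φ G).source ∧ ContDiffOn ℝ ∞ (φ G).symm (φ G).target ∧
      (∀ x ∈ (φ G).source, x ∈ orbit A Q ↔ φ G x ∈ tangent Q) ∧
      ∀ B ∈ (φ G).target, toAnti Q B ∈ (cayleyChart (1 : unitaryGp A)).target ∧
        (B ∈ tangent Q →
          (φ G).symm B = conj (G * (cayleyChart (1 : unitaryGp A)).symm (toAnti Q B)) Q) := by
  obtain ⟨φ, h0, h1, h2, h3, h4⟩ := exists_straightening hQ
  refine ⟨fun G => (conjHomeomorph G).symm.transOpenPartialHomeomorph φ, fun G =>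
    ⟨?_, ?_, ?_, fun x hx => ?_, fun B hB => ⟨(h4 B hB).1, fun hB' => ?_⟩⟩⟩
  · change conj G⁻¹ (conj G Q) ∈ φ.source
    rwa [conj_inv_conj]
  · exact h1.comp (contDiff_conj G⁻¹).contDiffOn fun x hx => hx
  · exact (contDiff_conj G).comp_contDiffOn h2
  · change conj G⁻¹ x ∈ φ.source at hx
    change _ ↔ φ (conj G⁻¹ x) ∈ _
    -- The orbit is invariant under the group, so the claim reduces to a neighbourhood of `Q`.
    -- There, orbit points are idempotent and hence straightened into `tangent Q`; conversely, the
    -- formula for `φ.symm` on `tangent Q` exhibits a conjugate of `Q`.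
    rw [← conj_mem_orbit (G := G⁻¹)]
    refine ⟨fun h => (h3 _ hx).1 (orbit_subset_grassmannian hQ h), fun h => ?_⟩
    rw [← φ.left_inv hx, (h4 _ (φ.map_source hx)).2 h]
    exact ⟨_, rfl⟩
  · change conj G (φ.symm B) = conj (G * (1 * cayleyInvGp A (toAnti Q B))) Q
    rw [(h4 B hB).2 hB', one_mul, conj_mul]

/-- Each orbit is relatively open in the Grassmannian. -/
theorem exists_isOpen_inter_grassmannian_subset_orbit (hQ : Q ∈ grassmannian A) :
    ∃ V : Set (symmOp A), IsOpen V ∧ Q ∈ V ∧ V ∩ grassmannian A ⊆ orbit A Q := by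
  obtain ⟨φ, h0, h1, h2, h3, h4⟩ := exists_straightening hQ
  refine ⟨φ.source, φ.open_source, h0, fun x hx => ?_⟩
  rw [← φ.left_inv hx.1, (h4 _ (φ.map_source hx.1)).2 ((h3 x hx.1).1 hx.2)]
  exact ⟨_, rfl⟩

/-! ### Submanifold structures and connected components -/

theorem closedComplemented_tangent (hQ : Q ∈ grassmannian A) : (tangent Q).ClosedComplemented :=
  ⟨tangentProj hQ, tangentProj_coe hQ⟩

theorem isComplementedSubmanifold_grassmannian :
    IsComplementedSubmanifold (grassmannian A) := by
  intro Q hQ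
  obtain ⟨φ, h0, h1, h2, h3, -⟩ := exists_straightening hQ
  exact ⟨φ, tangent Q, h0, h1, h2, closedComplemented_tangent hQ, h3⟩

theorem isComplementedSubmanifold_orbit (hQ : Q ∈ grassmannian A) :
    IsComplementedSubmanifold (orbit A Q) := by
  rintro _ ⟨G, rfl⟩
  obtain ⟨φ, hφ⟩ := exists_orbit_straightening hQ
  obtain ⟨h0, h1, h2, h3, -⟩ := hφ G
  exact ⟨φ G, tangent Q, h0, h1, h2, closedComplemented_tangent hQ, h3⟩

/-- Orbits are relatively open and partition the Grassmannian, so a connected subset meeting one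
orbit stays inside it. -/
theorem orbit_eq_iUnion_connectedComponentIn (hQ : Q ∈ grassmannian A) :
    orbit A Q = ⋃ B ∈ orbit A Q, connectedComponentIn (grassmannian A) B := by
  refine Set.Subset.antisymm (fun B hB => Set.mem_biUnion hB
    (mem_connectedComponentIn (orbit_subset_grassmannian hQ hB))) (Set.iUnion₂_subset ?_)
  intro B hB C hC
  have hBg := orbit_subset_grassmannian hQ hB
  have hCg := connectedComponentIn_subset _ _ hC
  by_contra hCo
  -- If the component of `B` left the orbit, the neighbourhoods of points on the orbit and of points
  -- off it would form two open sets covering the component and both meeting it. A common point `D`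
  -- in the component would then lie in an orbit equal to that of `Q` and in one different from it.
  choose! V hVo hVm hV using fun (R : symmOp A) (hR : R ∈ grassmannian A) =>
    exists_isOpen_inter_grassmannian_subset_orbit hR
  obtain ⟨D, hD, hD1, hD2⟩ := isPreconnected_connectedComponentIn
    (⋃ R ∈ orbit A Q, V R) (⋃ R ∈ grassmannian A \ orbit A Q, V R)
    (isOpen_biUnion fun R hR => hVo R (orbit_subset_grassmannian hQ hR))
    (isOpen_biUnion fun R hR => hVo R hR.1)
    (fun R hR => by
      have hRg := connectedComponentIn_subset (grassmannian A) B hR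
      by_cases h : R ∈ orbit A Q
      · exact Or.inl (Set.mem_biUnion h (hVm R hRg))
      · exact Or.inr (Set.mem_biUnion ⟨hRg, h⟩ (hVm R hRg)))
    ⟨B, mem_connectedComponentIn hBg, Set.mem_biUnion hB (hVm B hBg)⟩
    ⟨C, hC, Set.mem_biUnion ⟨hCg, hCo⟩ (hVm C hCg)⟩
  have hDg := connectedComponentIn_subset _ _ hD
  obtain ⟨R, hR, hDR⟩ := Set.mem_iUnion₂.1 hD1
  obtain ⟨R', hR', hDR'⟩ := Set.mem_iUnion₂.1 hD2
  have e := orbit_eq_of_mem (hV R (orbit_subset_grassmannian hQ hR) ⟨hDR, hDg⟩)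
  have e' := orbit_eq_of_mem (hV R' hR'.1 ⟨hDR', hDg⟩)
  refine hR'.2 ?_
  rw [← orbit_eq_of_mem hR, ← e, e']
  exact mem_orbit_self

/-! ### The orbit map is a submersion -/

theorem commute_ringInverse_right {R : Type*} [Ring R] {a b : R} (h : Commute a b) :
    Commute a (Ring.inverse b) := by
  by_cases hb : IsUnit b
  · obtain ⟨v, rfl⟩ := hb
    rw [Ring.inverse_unit]
    exact h.units_inv_right
  · rw [Ring.inverse_non_unit _ hb]
    exact Commute.zero_right a

/-- The Cayley transform is a rational expression in `K`, so it commutes with whatever `K` commutes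
with. Together with the converse for the inverse transform, this shows that the chart at `1`
linearizes the stabilizer of `Q`. -/
theorem cayleyChart_one_mem_ker_toTangent (hQ : Q ∈ grassmannian A) {K : unitaryGp A}
    (h : conj K Q = Q) : cayleyChart 1 K ∈ (toTangent hQ).ker := by
  rw [mem_ker_toTangent]
  have hc : Commute (Q : H →L[ℂ] H) (toOp K) := (conj_eq_self_iff.1 h).symm
  change cayley (toOp (1⁻¹ * K)) * (Q : H →L[ℂ] H) = (Q : H →L[ℂ] H) * cayley (toOp (1⁻¹ * K))
  rw [inv_one, one_mul]
  exact ((hc.sub_right (Commute.one_right _)).mul_right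
    (commute_ringInverse_right (hc.add_right (Commute.one_right _)))).symm

theorem conj_cayleyChart_one_symm (hQ : Q ∈ grassmannian A) {Z : antiOp A}
    (hZ : Z ∈ (cayleyChart (1 : unitaryGp A)).target) (h : Z ∈ (toTangent hQ).ker) :
    conj ((cayleyChart (1 : unitaryGp A)).symm Z) Q = Q := by
  rw [mem_ker_toTangent] at h
  have hc : Commute (Q : H →L[ℂ] H) (Z : H →L[ℂ] H) := h.symm
  rw [conj_eq_self_iff]
  have e : toOp ((cayleyChart (1 : unitaryGp A)).symm Z) = cayleyInv (Z : H →L[ℂ] H) := by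
    change toOp (1 * cayleyInvGp A Z) = _
    rw [one_mul]
    exact coe_cayleyInvGp hZ.1 hZ.2
  rw [e]
  exact (((Commute.one_right _).add_right hc).mul_right
    (commute_ringInverse_right ((Commute.one_right _).sub_right hc))).symm

theorem inv_mem_cayleyChart_one_source {K : unitaryGp A}
    (h : K ∈ (cayleyChart (1 : unitaryGp A)).source) :
    K⁻¹ ∈ (cayleyChart (1 : unitaryGp A)).source := by
  change IsUnit (toOp (1⁻¹ * K) + 1) at h
  change IsUnit (toOp (1⁻¹ * K⁻¹) + 1)
  rw [inv_one, one_mul] at h ⊢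
  -- Factoring out the invertible `K⁻¹` transfers invertibility from `K + 1` to `K⁻¹ + 1`.
  have : toOp K⁻¹ + 1 = toOp K⁻¹ * (toOp K + 1) := by
    rw [mul_add, toOp_inv_mul, mul_one, add_comm]
  rw [this]
  exact (Units.isUnit ((K⁻¹ : unitaryGp A) : (H →L[ℂ] H)ˣ)).mul h

theorem contMDiffOn_cayleyChart (G : unitaryGp A) :
    ContMDiffOn 𝓘(ℝ, antiOp A) 𝓘(ℝ, antiOp A) ∞ (cayleyChart G) (cayleyChart G).source :=
  contMDiffOn_of_mem_maximalAtlas (IsManifold.subset_maximalAtlas ⟨G, rfl⟩)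

theorem contMDiffOn_cayleyChart_symm (G : unitaryGp A) :
    ContMDiffOn 𝓘(ℝ, antiOp A) 𝓘(ℝ, antiOp A) ∞ (cayleyChart G).symm (cayleyChart G).target :=
  contMDiffOn_symm_of_mem_maximalAtlas (IsManifold.subset_maximalAtlas ⟨G, rfl⟩)

theorem exists_chartedSpace_orbit (hQ : Q ∈ grassmannian A) :
    ∃ (_ : ChartedSpace (tangent Q) (orbit A Q)),
      IsManifold 𝓘(ℝ, tangent Q) ∞ (orbit A Q) ∧
      Manifold.IsSmoothEmbedding 𝓘(ℝ, tangent Q) 𝓘(ℝ, symmOp A) ∞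
        (Subtype.val : orbit A Q → symmOp A) ∧
      Manifold.IsSubmersion 𝓘(ℝ, antiOp A) 𝓘(ℝ, tangent Q) ∞ (orbitMap A Q) := by
  obtain ⟨φ, hφ⟩ := exists_orbit_straightening hQ
  choose h0 h1 h2 h3 h4 using hφ
  refine exists_chartedSpace_isSubmersion (p := toTangent hQ) (X := toAnti Q)
    (P := tangentProj hQ) (o := orbitMap A Q) (c := cayleyChart 1)
    (fun ⟨_, G, hG⟩ => ⟨G, Subtype.ext hG⟩)
    (contMDiff_conj Q) (contMDiffOn_cayleyChart 1) (contMDiffOn_cayleyChart_symm 1)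
    (fun K hK => inv_mem_cayleyChart_one_source hK) (tangentProj_coe hQ) (toTangent_toAnti hQ)
    (fun G K h _ => LinearMap.mem_ker.1 (cayleyChart_one_mem_ker_toTangent hQ ?_))
    (fun G Z hZ h => Subtype.ext ?_) h0 h1 h2 h3 (fun G y hy => (h4 G y hy).1)
    (fun G y hy => (h4 G y hy).2)
  · have h' : conj G Q = conj K Q := congrArg Subtype.val h
    rw [conj_mul, h', conj_inv_conj]
  · change conj (G * _) Q = conj G Q
    rw [conj_mul, conj_cayleyChart_one_symm hQ hZ h]

end CompatGr

end

theorem corollary4p5 {H : Type*} [NormedAddCommGroup H] [InnerProductSpace ℂ H] [CompleteSpace H]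
    (A : H →L[ℂ] H) (hA : A.IsPositive) (hA_inj : Function.Injective A) :
    (∀ Q₀ ∈ CompatGr.grassmannian A,
      -- the orbit is a complemented submanifold
      CompatGr.IsComplementedSubmanifold (CompatGr.orbit A Q₀) ∧
      -- with its submanifold structure, `G ↦ G Q₀ G⁻¹` is a submersion onto it
      (∃ (F : Submodule ℝ (CompatGr.symmOp A)) (_ : ChartedSpace F (CompatGr.orbit A Q₀)),
        F.ClosedComplemented ∧
        IsManifold 𝓘(ℝ, F) ∞ (CompatGr.orbit A Q₀) ∧
        Manifold.IsSmoothEmbedding 𝓘(ℝ, F) 𝓘(ℝ, CompatGr.symmOp A) ∞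
          (Subtype.val : CompatGr.orbit A Q₀ → CompatGr.symmOp A) ∧
        Manifold.IsSubmersion 𝓘(ℝ, CompatGr.antiOp A) 𝓘(ℝ, F) ∞ (CompatGr.orbitMap A Q₀)) ∧
      -- the orbit is a union of connected components of the Grassmannian
      (∃ T ⊆ CompatGr.grassmannian A,
        CompatGr.orbit A Q₀ = ⋃ Q ∈ T, connectedComponentIn (CompatGr.grassmannian A) Q)) ∧
    CompatGr.IsComplementedSubmanifold (CompatGr.grassmannian A) := by
  exact ⟨fun Q₀ hQ => ⟨CompatGr.isComplementedSubmanifold_orbit hQ,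
    ⟨CompatGr.tangent Q₀, (CompatGr.exists_chartedSpace_orbit hQ).imp fun _ h =>
      ⟨CompatGr.closedComplemented_tangent hQ, h⟩⟩,
    ⟨CompatGr.orbit A Q₀, CompatGr.orbit_subset_grassmannian hQ,
      CompatGr.orbit_eq_iUnion_connectedComponentIn hQ⟩⟩,
    CompatGr.isComplementedSubmanifold_grassmannian⟩
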